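/- Setting. Let $d\ge 1$ and $r_1,\dots,r_d\ge1$, and put $\mathcal R=[r_1]\times\cdots\times[r_d]$, where $[s]=\{1,\dots,s\}$. For an array $a\in\mathbb R^{r_1\times\cdots\times r_d}$ let $\mathrm{Supp}(a)=\{i\in\mathcal R: a_i\ne0\}$, let $a^{(\ell)}_k=\sum_{i\in\mathcal R:\,i_\ell=k}a_i$ be the entries of its margins, and let $\underline a=\mathrm{vec}(a)\in\mathbb R^{N}$, $N=\prod_\ell r_\ell$, be its column-major vectorisation. Let $\mathcal P$ be the set of arrays with entries in $[0,1]$ summing to $1$ and with all $a^{(\ell)}_k>0$, let $\Gamma$ be the set of $\gamma\in\mathcal P$ with $\gamma^{(\ell)}_k=1/r_\ell$ for all $\ell,k$, and for $S\subseteq\mathcal R$ let $\mathcal P(S)$ and $\Gamma(S)$ be the subsets of the arrays with support exactly $S$. Let $\mathcal I(q\|p)=\sum_{i\in \mathrm{Supp}(p)}q_i\log(q_i/p_i)$ (with $0\log0=0$) if $\mathrm{Supp}(q)\subseteq\mathrm{Supp}(p)$, and $\mathcal I(q\|p)=\infty$ otherwise. Let $P$ be a probability measure on a grid $\mathcal X_1\times\cdots\times\mathcal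 X_d$ with $\mathcal X_\ell=\{x^{(\ell)}_1<\dots<x^{(\ell)}_{r_\ell}\}\subset\mathbb R$, let $p_i=P(\{(x^{(1)}_{i_1},\dots,x^{(d)}_{i_d})\})$, and suppose that $p\in\mathcal P(S)$. Let $\Delta^\circ(S)$ be the space of arrays supported in $S$ with all margins zero, and assume that $\Gamma(S)\neq\emptyset$ and $d_\circ=\dim\Delta^\circ(S)\ge1$. Fix a basis $\Delta_1,\dots,\Delta_{d_\circ}$ of $\Delta^\circ(S)$. Let $q_i=\mathbf 1\{i\in S\}/|S|$. For $p'\in\mathcal P(S)$ let $\gamma_{p'}=\arg\min_{\gamma\in\Gamma}\mathcal I(\gamma\|p')$, and put $$\gamma(\theta)=\gamma_q+\sum_{k}\theta_k\Delta_k,\qquad \Theta=\{\theta\in\mathbb R^{d_\circ}:0<\gamma(\theta)_i<1\ \ \forall i\in S\},\qquad \theta^*(\underline p')=\arg\min_{\theta\in\Theta}\mathcal I(\gamma(\theta)\|p').$$ Let $A$ be the $N\times d_\circ$ matrix with columns $\underline\Delta_k$, let $R$ be the matrix formed by the rows of the $N\times N$ identity matrix that correspond to $S$, and let $\tilde A=RA$.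 For $v\in\mathbb R^N$ put $M(v)=\tilde A^{\top}\mathrm{diag}^{-1}(Rv)\tilde A$, and $$J_{\theta^*}(\underline p)=M(\underline\gamma^*(\underline p))^{-1}\tilde A^{\top}\mathrm{diag}^{-1}(R\underline p)R,\quad \underline\gamma^*(\underline p)=\mathrm{vec}\,\gamma(\theta^*(\underline p)),\qquad \Sigma_\theta=M(\underline\gamma_p)^{-1}M(\underline p)M(\underline\gamma_p)^{-1}.$$ Let $X_1,X_2,\dots$ be random vectors on one probability space, each with distribution $P$ and possibly dependent. Let $p_n$ be the array of empirical frequencies of the grid points among $X_1,\dots,X_n$, and put $\hat p_n=\frac n{n+1}p_n+\frac1{n+1}q$, $\hat\theta_n=\theta^*(\mathrm{vec}\,\hat p_n)$, $\theta_p=\theta^*(\underline p)$. Proposition. These objects are well defined: $q\in\mathcal P(S)$; for every $p'\in\mathcal P(S)$ both minimisers exist and are unique, and $\gamma_{p'}\in\Gamma(S)$; almost surely $\hat p_n\in\mathcal P(S)$ for all $n$; $\gamma_p=\gamma(\theta_p)$; $M(\underline\gamma_p)$ is positive definite; and $\mathrm{diag}(\underline p)-\underline p\,\underline p^{\top}$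 and $\Sigma_\theta$ are positive semidefinite. Moreover: (a) If $\hat p_n\to p$ in probability (respectively almost surely), then $\hat\theta_n\to\theta_p$ in probability (respectively almost surely). (b) If $\rho_n\,(\mathrm{vec}\,\hat p_n-\underline p)\to Z$ in law for some real numbers $\rho_n\to\infty$ and some $N$-dimensional random vector $Z$, then $\rho_n(\hat\theta_n-\theta_p)\to J_{\theta^*}(\underline p)Z$ in law. (c) If $X_1,X_2,\dots$ are independent (hence i.i.d. with law $P$), then $\sqrt n\,(\mathrm{vec}\,\hat p_n-\underline p)\to\mathcal N(0,\mathrm{diag}(\underline p)-\underline p\,\underline p^{\top})$ in law and $\sqrt n\,(\hat\theta_n-\theta_p)\to\mathcal N(0,\Sigma_\theta)$ in law. -/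

import Mathlib

open Filter Topology MeasureTheory ProbabilityTheory

noncomputable section

namespace DiscreteCopula

/-- The set `[r₁] × ⋯ × [r_d]` of multi-indices. -/
abbrev Idx {d : ℕ} (r : Fin d → ℕ) : Type := (l : Fin d) → Fin (r l)

/-- The space `ℝ^{r₁ × ⋯ × r_d}` of `d`-dimensional arrays. -/
abbrev Arr {d : ℕ} (r : Fin d → ℕ) : Type := Idx r → ℝ

/-- The space `ℝ^{∏ r_l}` of vectors, with its Euclidean structure. -/
abbrev Vect {d : ℕ} (r : Fin d → ℕ) : Type := EuclideanSpace ℝ (Fin (∏ l, r l))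

variable {d : ℕ} {r : Fin d → ℕ}

/-- The support of an array. -/
def supp (a : Arr r) : Finset (Idx r) := {i | a i ≠ 0}

/-- The `k`-th entry of the `l`-th margin of an array. -/
def margin (a : Arr r) (l : Fin d) (k : Fin (r l)) : ℝ := ∑ i : Idx r with i l = k, a i

/-- Probability arrays without identically null slice. -/
def probArrays (r : Fin d → ℕ) : Set (Arr r) :=
  {p | (∀ i, p i ∈ Set.Icc (0 : ℝ) 1) ∧ ∑ i, p i = 1 ∧ ∀ l k, 0 < margin p l k}

/-- Probability arrays (without identically null slice) with support `S`. -/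
def probArraysOn (S : Finset (Idx r)) : Set (Arr r) := {p | p ∈ probArrays r ∧ supp p = S}

/-- Copula arrays: probability arrays all of whose margins are uniform. -/
def copulaArrays (r : Fin d → ℕ) : Set (Arr r) :=
  {g | g ∈ probArrays r ∧ ∀ l k, margin g l k = 1 / (r l : ℝ)}

/-- Copula arrays with support `S`. -/
def copulaArraysOn (S : Finset (Idx r)) : Set (Arr r) := {g | g ∈ copulaArrays r ∧ supp g = S}

/-- The `I`-divergence (Kullback-Leibler divergence) of `q` with respect to `p`.  The convention
`0 log 0 = 0` holds because the factor `q i` vanishes. -/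
def iDiv (q p : Arr r) : EReal :=
  if supp q ⊆ supp p then ((∑ i ∈ supp p, q i * Real.log (q i / p i) : ℝ) : EReal) else ⊤

/-- `a` is the unique minimiser of `f` over `s`. -/
def IsUniqueArgMin {α : Type*} (f : α → EReal) (s : Set α) (a : α) : Prop :=
  a ∈ s ∧ ∀ b ∈ s, b ≠ a → f a < f b

/-- The minimiser of `f` over `s` (an arbitrary point if there is none). -/
def argMin {α : Type*} [Nonempty α] (f : α → EReal) (s : Set α) : α :=
  Classical.epsilon fun a => a ∈ s ∧ IsMinOn f s a

/-- The `I`-projection of `p` on a set `F` of arrays. -/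
def iProj (F : Set (Arr r)) (p : Arr r) : Arr r := argMin (fun q => iDiv q p) F

/-- The copula array `γ_p` of `p`. -/
def copulaArray (p : Arr r) : Arr r := iProj (copulaArrays r) p

/-- The uniform array on `S`. -/
def unifArray (S : Finset (Idx r)) : Arr r := fun i => if i ∈ S then 1 / (S.card : ℝ) else 0

/-- The quasi-independence copula array `γ^{(q,S)}` with support `S`. -/
def quasiIndep (S : Finset (Idx r)) : Arr r := iProj (copulaArrays r) (unifArray S)

/-- The space `Δ°(S)` of arrays supported in `S` all of whose margins vanish. -/
def nullMargins (S : Finset (Idx r)) : Submodule ℝ (Arr r) where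
  carrier := {a | supp a ⊆ S ∧ ∀ l k, margin a l k = 0}
  zero_mem' := by simp [supp, margin]
  add_mem' := by
    rintro a b ⟨ha, ha'⟩ ⟨hb, hb'⟩
    refine ⟨fun i hi => ?_, fun l k => ?_⟩
    · by_contra h
      have h1 : a i = 0 := by
        by_contra h'
        exact h (ha (by simpa [supp] using h'))
      have h2 : b i = 0 := by
        by_contra h'
        exact h (hb (by simpa [supp] using h'))
      simp [supp, h1, h2] at hi
    · have h1 := ha' l k
      have h2 := hb' l k
      simp only [margin] at h1 h2 ⊢
      simp [Finset.sum_add_distrib, h1, h2]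
  smul_mem' := by
    rintro c a ⟨ha, ha'⟩
    refine ⟨fun i hi => ha ?_, fun l k => ?_⟩
    · simp only [supp, Finset.mem_filter, Finset.mem_univ, true_and, Pi.smul_apply,
        smul_eq_mul] at hi ⊢
      exact right_ne_zero_of_mul hi
    · have h1 := ha' l k
      simp only [margin] at h1 ⊢
      simp [← Finset.mul_sum, h1]

/-- The dimension `d_∘` of `Δ°(S)`. -/
def dCirc (S : Finset (Idx r)) : ℕ := Module.finrank ℝ (nullMargins S)

/-- The parameter vectors `θ ∈ ℝ^{d_∘}`. -/
abbrev Param (S : Finset (Idx r)) : Type := EuclideanSpace ℝ (Fin (dCirc S))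

/-- Column-major vectorisation: `finPiFinEquiv` sends `i` (entries counted from `0`) to
`∑ l, i l * ∏ l' < l, r l'`. -/
def vec (a : Arr r) : Vect r := WithLp.toLp 2 fun j => a (finPiFinEquiv.symm j)

/-- The inverse of `vec`. -/
def unvec (v : Vect r) : Arr r := fun i => v (finPiFinEquiv i)

section Parametrisation

variable {S : Finset (Idx r)} (Δ : Module.Basis (Fin (dCirc S)) ℝ (nullMargins S))

/-- The affine map `θ ↦ γ(θ) = γ^{(q,S)} + ∑ k, θ_k Δ_k`. -/
def gam (θ : Param S) : Arr r := quasiIndep S + ∑ k, θ k • (Δ k : Arr r)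

/-- The admissible parameter set `Θ`. -/
def paramSet : Set (Param S) := {θ | ∀ i ∈ S, 0 < gam Δ θ i ∧ gam Δ θ i < 1}

/-- The function `θ*` : the minimiser over `Θ` of the `I`-divergence of `γ(θ)` with respect to the
array whose vectorisation is `v`. -/
def thetaStar (v : Vect r) : Param S := argMin (fun θ => iDiv (gam Δ θ) (unvec v)) (paramSet Δ)

/-- The function `γ*`, `v ↦ vec γ(θ*(v))`. -/
def gamStar (v : Vect r) : Vect r := vec (gam Δ (thetaStar Δ v))

/-- The matrix `A_S` whose columns are the vectorised basis elements. -/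
def matA : Matrix (Fin (∏ l, r l)) (Fin (dCirc S)) ℝ := Matrix.of fun j k => vec (Δ k : Arr r) j

/-- The selection matrix `R_S`: the identity matrix restricted to the rows of index in `S`. -/
def matR (S : Finset (Idx r)) : Matrix S (Fin (∏ l, r l)) ℝ :=
  (1 : Matrix (Fin (∏ l, r l)) (Fin (∏ l, r l)) ℝ).submatrix
    (fun i : S => finPiFinEquiv (i : Idx r)) id

/-- `Ã_S = R_S A_S`. -/
def matAt : Matrix S (Fin (dCirc S)) ℝ := matR S * matA Δ

/-- `diag⁻¹(R_S v)`. -/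
def invDiag (S : Finset (Idx r)) (v : Vect r) : Matrix S S ℝ :=
  (Matrix.diagonal (Matrix.mulVec (matR S) v.ofLp))⁻¹

/-- `Ã_Sᵀ diag⁻¹(R_S v) Ã_S`. -/
def infoMat (v : Vect r) : Matrix (Fin (dCirc S)) (Fin (dCirc S)) ℝ :=
  (matAt Δ).transpose * invDiag S v * matAt Δ

/-- The Jacobian matrix `J_{θ*}(v)`. -/
def jacTheta (v : Vect r) : Matrix (Fin (dCirc S)) (Fin (∏ l, r l)) ℝ :=
  (infoMat Δ (gamStar Δ v))⁻¹ * (matAt Δ).transpose * invDiag S v * matR S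

/-- The sandwich covariance matrix `Σ_θ`. -/
def sigmaTheta (p : Arr r) : Matrix (Fin (dCirc S)) (Fin (dCirc S)) ℝ :=
  (infoMat Δ (vec (copulaArray p)))⁻¹ * infoMat Δ (vec p) * (infoMat Δ (vec (copulaArray p)))⁻¹

end Parametrisation

/-- The multinomial covariance matrix `diag(v) - v vᵀ`. -/
def multinomialCov (v : Vect r) : Matrix (Fin (∏ l, r l)) (Fin (∏ l, r l)) ℝ :=
  Matrix.diagonal v.ofLp - Matrix.vecMulVec v.ofLp v.ofLp

/-- The point `(x^{(1)}_{i_1}, …, x^{(d)}_{i_d})`. -/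
def gridPt (x : (l : Fin d) → Fin (r l) → ℝ) (i : Idx r) : Fin d → ℝ := fun l => x l (i l)

/-- The probability array of a probability measure `P` supported by the grid. -/
def probArrayOf (x : (l : Fin d) → Fin (r l) → ℝ) (P : Measure (Fin d → ℝ)) : Arr r :=
  fun i => P.real {gridPt x i}

section Sample

variable {Ω : Type*} (x : (l : Fin d) → Fin (r l) → ℝ) (S : Finset (Idx r))
  (X : ℕ → Ω → Fin d → ℝ)

/-- The empirical probability array of the first `n` observations `X 0, …, X (n - 1)`. -/
def empArray (n : ℕ) (ω : Ω) : Arr r :=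
  fun i => (1 / (n : ℝ)) * ∑ k ∈ Finset.range n, Set.indicator {gridPt x i} (fun _ => (1 : ℝ)) (X k ω)

/-- The smoothed empirical probability array `p̂_n = n/(n+1) p_n + 1/(n+1) q`, with `q` uniform
on `S`. -/
def pHat (n : ℕ) (ω : Ω) : Arr r :=
  ((n : ℝ) / (n + 1)) • empArray x X n ω + (1 / ((n : ℝ) + 1)) • unifArray S

/-- The estimator `θ̂_n = θ*(vec p̂_n)`. -/
def thetaHat {S : Finset (Idx r)} (Δ : Module.Basis (Fin (dCirc S)) ℝ (nullMargins S))
    (n : ℕ) (ω : Ω) : Param S :=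
  thetaStar Δ (vec (pHat x S X n ω))

end Sample

end DiscreteCopula

end

namespace DiscreteCopula

variable {d : ℕ} {r : Fin d → ℕ}

/-! ### Arrays, margins and supports -/

/-! For `p'` in 𝒫(S), a copula array `g` with support S minimises I(·‖p') exactly when log(g/p') is
orthogonal on S to Δ°(S) (`IsCritical`). Sufficiency and uniqueness come from the Pythagorean
identity I(g'‖p') − I(g‖p') = I(g'‖g) + ⟨g' − g, log(g/p')⟩ and Gibbs' inequality (`realDiv_lt`).
Existence comes from compactness of the copula arrays supported in S. Since t log t has slope −∞ at
0, moving towards a member of Γ(S) rules out zeros in S (`pos_of_realDiv_le`), so the minimiser is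
interior and its derivatives along Δ°(S) vanish (`exists_isCritical`).

In the coordinates θ, a bijection of Θ with Γ(S), criticality is the score equation Ãᵀ log Rγ(θ) =
Ãᵀ log Rp'. The left side has derivative M(γ(θ)), positive definite because Ã has full column rank.
By the inverse function theorem, θ* near p is the local inverse of the left side composed with the
right side. So θ* is differentiable at p relative to 𝒫(S), with Jacobian J
(`hasFDerivWithinAt_thetaStar`). Relative differentiability is enough because smoothing keeps p̂_n
in 𝒫(S) almost surely.

Continuity then gives (a), and a delta method relative to a set gives (b). For (c), the central
limit theorem applies to one-hot encodings, smoothing is negligible at scale √n, and J(diag p −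
ppᵀ)Jᵀ = Σ_θ (`jacTheta_mul_cov_mul_transpose`), the rank-one term vanishing because the columns of
A sum to zero. -/

lemma mem_supp {a : Arr r} {i : Idx r} : i ∈ supp a ↔ a i ≠ 0 := by simp [supp]

lemma supp_subset_iff {a : Arr r} {S : Finset (Idx r)} :
    supp a ⊆ S ↔ ∀ i, i ∉ S → a i = 0 := by
  constructor
  · intro h i hi
    by_contra h'
    exact hi (h (mem_supp.2 h'))
  · intro h i hi
    by_contra h'
    exact mem_supp.1 hi (h i h')

lemma sum_eq_of_supp_subset {a : Arr r} {S : Finset (Idx r)} (h : supp a ⊆ S) :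
    ∑ i ∈ S, a i = ∑ i, a i :=
  Finset.sum_subset (Finset.subset_univ _) fun i _ hi => supp_subset_iff.1 h i hi

lemma sum_margin (a : Arr r) (l : Fin d) : ∑ k, margin a l k = ∑ i, a i := by
  simp only [margin]
  exact Finset.sum_fiberwise _ _ _

lemma margin_add (a b : Arr r) (l : Fin d) (k : Fin (r l)) :
    margin (a + b) l k = margin a l k + margin b l k := by
  simp [margin, Finset.sum_add_distrib]

lemma margin_sub (a b : Arr r) (l : Fin d) (k : Fin (r l)) :
    margin (a - b) l k = margin a l k - margin b l k := by
  simp [margin, Finset.sum_sub_distrib]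

lemma sum_eq_zero_of_mem_nullMargins (hd : 1 ≤ d) {S : Finset (Idx r)} {a : Arr r}
    (ha : a ∈ nullMargins S) : ∑ i, a i = 0 := by
  rw [← sum_margin a ⟨0, hd⟩]
  exact Finset.sum_eq_zero fun k _ => ha.2 _ k

lemma probArraysOn_pos {S : Finset (Idx r)} {p : Arr r} (hp : p ∈ probArraysOn S) {i : Idx r}
    (hi : i ∈ S) : 0 < p i :=
  lt_of_le_of_ne (hp.1.1 i).1 (Ne.symm (mem_supp.1 (hp.2 ▸ hi)))

lemma probArraysOn_eq_zero {S : Finset (Idx r)} {p : Arr r} (hp : p ∈ probArraysOn S) {i : Idx r}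
    (hi : i ∉ S) : p i = 0 :=
  supp_subset_iff.1 hp.2.le i hi

lemma mem_probArraysOn_of_copula {S : Finset (Idx r)} {g : Arr r}
    (hg : g ∈ copulaArraysOn S) : g ∈ probArraysOn S := ⟨hg.1.1, hg.2⟩

lemma copulaArrays_sub_mem_nullMargins {S : Finset (Idx r)} {g g' : Arr r}
    (hg : g ∈ copulaArrays r) (hg' : g' ∈ copulaArrays r) (h : supp g ⊆ S) (h' : supp g' ⊆ S) :
    g' - g ∈ nullMargins S := by
  refine ⟨supp_subset_iff.2 fun i hi => ?_, fun l k => ?_⟩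
  · simp [supp_subset_iff.1 h i hi, supp_subset_iff.1 h' i hi]
  · rw [margin_sub, hg.2, hg'.2, sub_self]

/-- Nonnegative arrays with unit mass supported in `S` with every slice meeting `S` and positive
on `S` belong to `𝒫(S)`. -/
lemma mem_probArraysOn_of_pos {S : Finset (Idx r)} {p g : Arr r} (hp : p ∈ probArraysOn S)
    (hpos : ∀ i ∈ S, 0 < g i) (hzero : ∀ i, i ∉ S → g i = 0) (hsum : ∑ i, g i = 1) :
    g ∈ probArraysOn S := by
  have h0 : ∀ i, 0 ≤ g i := fun i => by
    by_cases hi : i ∈ S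
    · exact (hpos i hi).le
    · exact (hzero i hi).ge
  refine ⟨⟨fun i => ⟨h0 i, ?_⟩, hsum, fun l k => ?_⟩, ?_⟩
  · rw [← hsum]
    exact Finset.single_le_sum (fun j _ => h0 j) (Finset.mem_univ i)
  -- The only role of `p`: its positive margins show that every slice meets S.
  · obtain ⟨i, hi, hpi⟩ := Finset.exists_ne_zero_of_sum_ne_zero (hp.1.2.2 l k).ne'
    exact Finset.sum_pos' (fun j _ => h0 j)
      ⟨i, hi, hpos i (hp.2 ▸ mem_supp.2 hpi)⟩
  · ext i
    by_cases hi : i ∈ S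
    · simp [mem_supp, hi, (hpos i hi).ne']
    · simp [mem_supp, hi, hzero i hi]

lemma unifArray_mem_probArraysOn {S : Finset (Idx r)} {p : Arr r} (hp : p ∈ probArraysOn S) :
    unifArray S ∈ probArraysOn S := by
  have hS : S.Nonempty := by
    rw [Finset.nonempty_iff_ne_empty]
    rintro rfl
    have := hp.1.2.1
    simp [fun i => probArraysOn_eq_zero hp (Finset.notMem_empty i)] at this
  have hc : (0 : ℝ) < S.card := by exact_mod_cast hS.card_pos
  refine mem_probArraysOn_of_pos hp (fun i hi => ?_) (fun i hi => ?_) ?_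
  · simp [unifArray, hi, hS]
  · simp [unifArray, hi]
  · simp [unifArray, hc.ne']

/-! ### Unique minimisers -/

lemma IsUniqueArgMin.argMin_eq {α : Type*} [Nonempty α] {f : α → EReal} {s : Set α} {a : α}
    (h : IsUniqueArgMin f s a) : argMin f s = a := by
  have hex : ∃ b, b ∈ s ∧ IsMinOn f s b := by
    refine ⟨a, h.1, fun b hb => ?_⟩
    by_cases hab : b = a
    · simp [hab]
    · exact (h.2 b hb hab).le
  have hsp := Classical.epsilon_spec hex
  by_contra hne
  exact absurd (h.2 _ hsp.1 hne) (not_lt.2 (hsp.2 h.1))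

/-! ### The `I`-divergence -/

/-- The `I`-divergence of `g` from an array `p` of support `S`, as a real number. -/
noncomputable def realDiv (S : Finset (Idx r)) (g p : Arr r) : ℝ :=
  ∑ i ∈ S, g i * Real.log (g i / p i)

lemma iDiv_eq_realDiv {S : Finset (Idx r)} {g p : Arr r} (hp : supp p = S) (hg : supp g ⊆ S) :
    iDiv g p = (realDiv S g p : EReal) := by
  simp [iDiv, realDiv, hp, hg]

lemma iDiv_eq_top {S : Finset (Idx r)} {g p : Arr r} (hp : supp p = S) (hg : ¬ supp g ⊆ S) :
    iDiv g p = ⊤ := by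
  simp [iDiv, hp, hg]

/-- Pointwise Gibbs inequality, from log s < s − 1 at s = y/x. Summed over arrays of equal mass, it
makes the divergence strictly positive. -/
lemma sub_lt_mul_log_div {x y : ℝ} (hx : 0 ≤ x) (hy : 0 < y) (hxy : x ≠ y) :
    x - y < x * Real.log (x / y) := by
  rcases hx.eq_or_lt with rfl | hx
  · simpa using hy
  · have h1 : y / x ≠ 1 := fun h => hxy ((div_eq_one_iff_eq hx.ne').1 h).symm
    have h2 := Real.log_lt_sub_one_of_pos (div_pos hy hx) h1
    have h3 : Real.log (x / y) = - Real.log (y / x) := by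
      rw [← Real.log_inv, inv_div]
    have h4 := mul_lt_mul_of_pos_left h2 hx
    have h5 : x * (y / x - 1) = y - x := by field_simp
    rw [h3]
    linarith

/-- A positive array satisfying the first-order condition in the direction `g' - g` strictly
minimises the `I`-divergence between `g` and `g'`. -/
lemma realDiv_lt {S : Finset (Idx r)} {p g g' : Arr r} (hp : ∀ i ∈ S, 0 < p i)
    (hg : ∀ i ∈ S, 0 < g i) (hg' : ∀ i ∈ S, 0 ≤ g' i) (hne : ∃ i ∈ S, g' i ≠ g i)
    (hsum : ∑ i ∈ S, (g' i - g i) = 0)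
    (hcrit : ∑ i ∈ S, (g' i - g i) * Real.log (g i / p i) = 0) :
    realDiv S g p < realDiv S g' p := by
  -- Pythagorean decomposition entry by entry; the cross term sums to zero by `hcrit`.
  have key : ∀ i ∈ S, g' i * Real.log (g' i / p i) - g i * Real.log (g i / p i)
      = g' i * Real.log (g' i / g i) + (g' i - g i) * Real.log (g i / p i) := by
    intro i hi
    rcases (hg' i hi).eq_or_lt with h | h
    · simp [← h]
    · rw [Real.log_div h.ne' (hp i hi).ne', Real.log_div (hg i hi).ne' (hp i hi).ne',
        Real.log_div h.ne' (hg i hi).ne']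
      ring
  have h1 : realDiv S g' p - realDiv S g p = ∑ i ∈ S, g' i * Real.log (g' i / g i) := by
    rw [realDiv, realDiv, ← Finset.sum_sub_distrib, Finset.sum_congr rfl key,
      Finset.sum_add_distrib, hcrit, add_zero]
  have h2 : ∑ i ∈ S, (g' i - g i) < ∑ i ∈ S, g' i * Real.log (g' i / g i) := by
    obtain ⟨j, hj, hjne⟩ := hne
    refine Finset.sum_lt_sum (fun i hi => ?_)
      ⟨j, hj, sub_lt_mul_log_div (hg' j hj) (hg j hj) hjne⟩
    by_cases h : g' i = g i
    · simp [h]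
    · exact (sub_lt_mul_log_div (hg' i hi) (hg i hi) h).le
  linarith

lemma continuous_mul_log_div {c : ℝ} (hc : c ≠ 0) :
    Continuous fun x : ℝ => x * Real.log (x / c) := by
  have h : (fun x : ℝ => x * Real.log (x / c)) = fun x => c * ((x / c) * Real.log (x / c)) := by
    ext x
    field_simp
  rw [h]
  exact continuous_const.mul (Real.continuous_mul_log.comp (by fun_prop))

lemma continuous_realDiv {S : Finset (Idx r)} {p : Arr r} (hp : ∀ i ∈ S, 0 < p i) :
    Continuous fun g : Arr r => realDiv S g p :=
  continuous_finsetSum _ fun i hi =>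
    (continuous_mul_log_div (hp i hi).ne').comp (continuous_apply i)

/-- Convexity of s log s at s = x/c, rescaled by c. -/
lemma mul_log_div_convex {c x y t : ℝ} (hc : 0 < c) (hx : 0 ≤ x) (hy : 0 ≤ y) (ht0 : 0 ≤ t)
    (ht1 : t ≤ 1) :
    ((1 - t) * x + t * y) * Real.log (((1 - t) * x + t * y) / c)
      ≤ (1 - t) * (x * Real.log (x / c)) + t * (y * Real.log (y / c)) := by
  have h := Real.convexOn_mul_log.2 (x := x / c) (y := y / c) (div_nonneg hx hc.le)
    (div_nonneg hy hc.le) (sub_nonneg.2 ht1) ht0 (by ring)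
  simp only [smul_eq_mul] at h
  have e : (1 - t) * (x / c) + t * (y / c) = ((1 - t) * x + t * y) / c := by ring
  rw [e] at h
  have h2 := mul_le_mul_of_nonneg_left h hc.le
  calc _ = c * (((1 - t) * x + t * y) / c * Real.log (((1 - t) * x + t * y) / c)) := by
        field_simp
    _ ≤ _ := h2
    _ = _ := by field_simp

/-- A minimiser of the `I`-divergence along all segments towards a positive array is positive. -/
lemma pos_of_realDiv_le {S : Finset (Idx r)} {p g g₀ : Arr r} (hp : ∀ i ∈ S, 0 < p i)
    (hg : ∀ i ∈ S, 0 ≤ g i) (hg₀ : ∀ i ∈ S, 0 < g₀ i)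
    (hmin : ∀ t : ℝ, 0 < t → t ≤ 1 → realDiv S g p ≤ realDiv S (g + t • (g₀ - g)) p) :
    ∀ i ∈ S, 0 < g i := by
  intro j hj
  by_contra hneg
  have hgj : g j = 0 := le_antisymm (not_lt.1 hneg) (hg j hj)
  -- Along the segment the vanishing entry equals t g₀ j and contributes the extra term t g₀ j log
  -- t; convexity handles the other entries. Dividing by t leaves a bound that fails as t → 0.
  have hbound : ∀ t : ℝ, 0 < t → t ≤ 1 →
      realDiv S g p - realDiv S g₀ p ≤ g₀ j * Real.log t := by
    intro t ht0 ht1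
    have h1 : realDiv S (g + t • (g₀ - g)) p ≤
        (1 - t) * realDiv S g p + t * realDiv S g₀ p + t * (g₀ j * Real.log t) := by
      have h2 : ∀ i ∈ S, (g + t • (g₀ - g)) i * Real.log ((g + t • (g₀ - g)) i / p i) ≤
          (1 - t) * (g i * Real.log (g i / p i)) + t * (g₀ i * Real.log (g₀ i / p i))
            + if i = j then t * (g₀ j * Real.log t) else 0 := by
        intro i hi
        have e : (g + t • (g₀ - g)) i = (1 - t) * g i + t * g₀ i := by
          simp; ring
        rw [e]
        split_ifs with hij
        · subst hij
          rw [hgj, mul_zero, zero_add, mul_div_assoc,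
            Real.log_mul ht0.ne' (div_pos (hg₀ i hi) (hp i hi)).ne']
          apply le_of_eq
          ring
        · rw [add_zero]
          exact mul_log_div_convex (hp i hi) (hg i hi) (hg₀ i hi).le ht0.le ht1
      refine (Finset.sum_le_sum h2).trans (le_of_eq ?_)
      simp only [realDiv, Finset.sum_add_distrib, Finset.mul_sum, Finset.sum_ite_eq', hj, if_true]
    have h3 := (hmin t ht0 ht1).trans h1
    have h4 : t * (realDiv S g p - realDiv S g₀ p) ≤ t * (g₀ j * Real.log t) := by linarith
    exact le_of_mul_le_mul_left h4 ht0
  set c := (realDiv S g p - realDiv S g₀ p) / g₀ j with hc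
  have hpos := hg₀ j hj
  -- This t satisfies t ≤ 1 and log t ≤ c − 1, whereas the bound demands c ≤ log t.
  have h5 := hbound (Real.exp (min (c - 1) 0)) (Real.exp_pos _)
    (Real.exp_le_one_iff.2 (min_le_right _ _))
  rw [Real.log_exp] at h5
  have h6 : c ≤ min (c - 1) 0 := by
    rw [hc, div_le_iff₀ hpos]
    linarith
  linarith [min_le_left (c - 1) 0]

lemma hasDerivAt_realDiv_line {S : Finset (Idx r)} {p g a : Arr r} (hp : ∀ i ∈ S, 0 < p i)
    (hg : ∀ i ∈ S, 0 < g i) :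
    HasDerivAt (fun t : ℝ => realDiv S (g + t • a) p)
      (∑ i ∈ S, (a i * Real.log (g i / p i) + a i)) 0 := by
  unfold realDiv
  refine HasDerivAt.fun_sum fun i hi => ?_
  have h1 : HasDerivAt (fun t : ℝ => (g + t • a) i) (a i) 0 := by
    simpa using ((hasDerivAt_id (0 : ℝ)).mul_const (a i)).const_add (g i)
  have hz : (g + (0 : ℝ) • a) i = g i := by simp
  have hne : (g + (0 : ℝ) • a) i / p i ≠ 0 := by
    rw [hz]
    exact (div_pos (hg i hi) (hp i hi)).ne'
  have h2 := h1.mul ((h1.div_const (p i)).log hne)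
  refine h2.congr_deriv ?_
  rw [hz]
  have := (hg i hi).ne'
  have := (hp i hi).ne'
  field_simp

/-! ### The `I`-projection on the copula arrays -/

/-- Positivity of the margins is not a closed condition, but it follows from their being 1/r_l, so
only closed conditions inside a cube remain. -/
lemma isCompact_copulaArrays_supp (S : Finset (Idx r)) :
    IsCompact {g | g ∈ copulaArrays r ∧ supp g ⊆ S} := by
  have e : {g | g ∈ copulaArrays r ∧ supp g ⊆ S} =
      Set.Icc (0 : Arr r) 1 ∩ ({g | ∑ i, g i = 1} ∩
        ((⋂ l, ⋂ k, {g | margin g l k = 1 / (r l : ℝ)}) ∩ ⋂ i, ⋂ (_ : i ∉ S), {g | g i = 0})) := by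
    ext g
    simp only [copulaArrays, probArrays, supp_subset_iff, Set.mem_ofPred_eq, Set.mem_inter_iff,
      Set.mem_iInter, Set.mem_Icc, Pi.le_def, Pi.zero_apply, Pi.one_apply]
    constructor
    · rintro ⟨⟨⟨h1, h2, h3⟩, h4⟩, h5⟩
      exact ⟨⟨fun i => (h1 i).1, fun i => (h1 i).2⟩, h2, h4, h5⟩
    · rintro ⟨⟨h1, h1'⟩, h2, h4, h5⟩
      refine ⟨⟨⟨fun i => ⟨h1 i, h1' i⟩, h2, fun l k => ?_⟩, h4⟩, h5⟩
      rw [h4]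
      have : 0 < r l := k.pos
      positivity
  rw [e]
  refine isCompact_Icc.inter_right ?_
  refine (isClosed_eq (by fun_prop) (by fun_prop)).inter (IsClosed.inter ?_ ?_)
  · refine isClosed_iInter fun l => isClosed_iInter fun k => isClosed_eq ?_ (by fun_prop)
    unfold margin
    fun_prop
  · exact isClosed_iInter fun i => isClosed_iInter fun _ => isClosed_eq (by fun_prop) (by fun_prop)

/-- The array `g` satisfies the first-order conditions for the `I`-projection of `p`. -/
def IsCritical (S : Finset (Idx r)) (g p : Arr r) : Prop :=
  ∀ a ∈ nullMargins S, ∑ i ∈ S, a i * Real.log (g i / p i) = 0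

lemma add_mem_copulaArrays {g a : Arr r} (hd : 1 ≤ d) {S : Finset (Idx r)}
    (hg : g ∈ copulaArrays r) (ha : a ∈ nullMargins S) (h : ∀ i, 0 ≤ (g + a) i) :
    g + a ∈ copulaArrays r := by
  have hsum : ∑ i, (g + a) i = 1 := by
    simp [Finset.sum_add_distrib, hg.1.2.1, sum_eq_zero_of_mem_nullMargins hd ha]
  have hm : ∀ l k, margin (g + a) l k = margin g l k := fun l k => by
    rw [margin_add, ha.2, add_zero]
  refine ⟨⟨fun i => ⟨h i, ?_⟩, hsum, fun l k => ?_⟩, fun l k => ?_⟩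
  · rw [← hsum]
    exact Finset.single_le_sum (fun j _ => h j) (Finset.mem_univ i)
  · rw [hm]
    exact hg.1.2.2 l k
  · rw [hm]
    exact hg.2 l k

lemma exists_isCritical (hd : 1 ≤ d) {S : Finset (Idx r)} (hΓ : (copulaArraysOn S).Nonempty)
    {p : Arr r} (hp : p ∈ probArraysOn S) : ∃ g ∈ copulaArraysOn S, IsCritical S g p := by
  obtain ⟨g₀, hg₀⟩ := hΓ
  have hpp : ∀ i ∈ S, 0 < p i := fun i hi => probArraysOn_pos hp hi
  obtain ⟨g, ⟨hg, hgS⟩, hmin⟩ := (isCompact_copulaArrays_supp S).exists_isMinOn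
    ⟨g₀, hg₀.1, hg₀.2.le⟩ (continuous_realDiv hpp).continuousOn
  have hg0 : ∀ i, 0 ≤ g i := fun i => (hg.1.1 i).1
  have hpos : ∀ i ∈ S, 0 < g i := by
    refine pos_of_realDiv_le hpp (fun i _ => hg0 i)
      (fun i hi => probArraysOn_pos (mem_probArraysOn_of_copula hg₀) hi) fun t ht0 ht1 => hmin ?_
    have hsub := copulaArrays_sub_mem_nullMargins hg hg₀.1 hgS hg₀.2.le
    have hmem := (nullMargins S).smul_mem t hsub
    refine ⟨add_mem_copulaArrays hd hg hmem fun i => ?_, ?_⟩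
    · have h1 := hg0 i
      have h2 := (hg₀.1.1.1 i).1
      have e : (g + t • (g₀ - g)) i = (1 - t) * g i + t * g₀ i := by simp; ring
      rw [e]
      have := sub_nonneg.2 ht1
      positivity
    · refine supp_subset_iff.2 fun i hi => ?_
      have := supp_subset_iff.1 hmem.1 i hi
      simp only [Pi.add_apply, this, supp_subset_iff.1 hgS i hi, add_zero]
  refine ⟨g, ⟨hg, hgS.antisymm fun i hi => mem_supp.2 (hpos i hi).ne'⟩, fun a ha => ?_⟩
  -- Positivity on S leaves room in both directions ±a, so the derivative at 0 vanishes; its term ∑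
  -- a i is zero as well.
  have hloc : IsLocalMin (fun t : ℝ => realDiv S (g + t • a) p) 0 := by
    have hev : ∀ᶠ t : ℝ in 𝓝 0, ∀ i ∈ S, 0 < (g + t • a) i := by
      refine (Finset.eventually_all S).2 fun i hi => ?_
      have hc : ContinuousAt (fun t : ℝ => (g + t • a) i) 0 := by
        simp only [Pi.add_apply, Pi.smul_apply, smul_eq_mul]
        fun_prop
      refine hc.eventually (lt_mem_nhds ?_)
      simpa using hpos i hi
    filter_upwards [hev] with t ht
    have hmem := (nullMargins S).smul_mem t ha
    have hz : ∀ i, i ∉ S → (g + t • a) i = 0 := fun i hi => by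
      have := supp_subset_iff.1 hmem.1 i hi
      simp only [Pi.add_apply, this, supp_subset_iff.1 hgS i hi, add_zero]
    have hle := hmin (a := g + t • a) ⟨add_mem_copulaArrays hd hg hmem fun i => by
      by_cases hi : i ∈ S
      · exact (ht i hi).le
      · exact (hz i hi).ge, supp_subset_iff.2 hz⟩
    simpa using hle
  have hder := hloc.hasDerivAt_eq_zero (hasDerivAt_realDiv_line (a := a) hpp hpos)
  rwa [Finset.sum_add_distrib, sum_eq_of_supp_subset ha.1, sum_eq_zero_of_mem_nullMargins hd ha,
    add_zero] at hder

/-- First-order conditions are sufficient for strict minimality among copula arrays. -/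
lemma IsCritical.realDiv_lt (hd : 1 ≤ d) {S : Finset (Idx r)} {p g g' : Arr r}
    (hp : p ∈ probArraysOn S) (hg : g ∈ copulaArraysOn S) (hc : IsCritical S g p)
    (hg' : g' ∈ copulaArrays r) (hS : supp g' ⊆ S) (hne : g' ≠ g) :
    realDiv S g p < realDiv S g' p := by
  have hmem := copulaArrays_sub_mem_nullMargins hg.1 hg' hg.2.le hS
  refine DiscreteCopula.realDiv_lt (fun i hi => probArraysOn_pos hp hi)
    (fun i hi => probArraysOn_pos (mem_probArraysOn_of_copula hg) hi)
    (fun i _ => (hg'.1.1 i).1) ?_ ?_ (hc _ hmem)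
  · by_contra! h
    refine hne (funext fun i => ?_)
    by_cases hi : i ∈ S
    · exact h i hi
    · rw [supp_subset_iff.1 hS i hi, probArraysOn_eq_zero (mem_probArraysOn_of_copula hg) hi]
  · exact (sum_eq_of_supp_subset hmem.1).trans (sum_eq_zero_of_mem_nullMargins hd hmem)

/-- Competitors charging a point outside S have infinite divergence, so only those supported in S
matter. -/
lemma IsCritical.isUniqueArgMin (hd : 1 ≤ d) {S : Finset (Idx r)} {p g : Arr r}
    (hp : p ∈ probArraysOn S) (hg : g ∈ copulaArraysOn S) (hc : IsCritical S g p) :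
    IsUniqueArgMin (fun g => iDiv g p) (copulaArrays r) g := by
  refine ⟨hg.1, fun b hb hne => ?_⟩
  dsimp only
  rw [iDiv_eq_realDiv hp.2 hg.2.le]
  by_cases hS : supp b ⊆ S
  · rw [iDiv_eq_realDiv hp.2 hS]
    exact_mod_cast hc.realDiv_lt hd hp hg hb hS hne
  · rw [iDiv_eq_top hp.2 hS]
    exact EReal.coe_lt_top _

lemma copulaArray_eq_of_isCritical (hd : 1 ≤ d) {S : Finset (Idx r)} {p g : Arr r}
    (hp : p ∈ probArraysOn S) (hg : g ∈ copulaArraysOn S) (hc : IsCritical S g p) :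
    copulaArray p = g := (hc.isUniqueArgMin hd hp hg).argMin_eq

lemma copulaArray_spec (hd : 1 ≤ d) {S : Finset (Idx r)} (hΓ : (copulaArraysOn S).Nonempty)
    {p : Arr r} (hp : p ∈ probArraysOn S) :
    copulaArray p ∈ copulaArraysOn S ∧ IsCritical S (copulaArray p) p := by
  obtain ⟨g, hg, hc⟩ := exists_isCritical hd hΓ hp
  rw [copulaArray_eq_of_isCritical hd hp hg hc]
  exact ⟨hg, hc⟩

/-- An entry equal to 1 would take all the mass, leaving S at most one point and Δ°(S) trivial.
Hence the upper bound in Θ excludes nothing from Γ(S). -/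
lemma copulaArraysOn_lt_one (hd : 1 ≤ d) {S : Finset (Idx r)} (hdim : 1 ≤ dCirc S) {g : Arr r}
    (hg : g ∈ copulaArraysOn S) (i : Idx r) : g i < 1 := by
  by_contra hge
  have hone : ∀ j ∈ S, j = i := by
    intro j hj
    by_contra hne
    have h1 := probArraysOn_pos (mem_probArraysOn_of_copula hg) hj
    have h2 : ∑ k ∈ ({i, j} : Finset (Idx r)), g k ≤ ∑ k, g k :=
      Finset.sum_le_sum_of_subset_of_nonneg (Finset.subset_univ _) fun k _ _ => (hg.1.1.1 k).1
    rw [Finset.sum_pair (Ne.symm hne), hg.1.1.2.1] at h2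
    linarith
  have hbot : nullMargins S = ⊥ := by
    rw [Submodule.eq_bot_iff]
    intro a ha
    have hz : ∀ j, j ≠ i → a j = 0 := fun j hj =>
      supp_subset_iff.1 ha.1 j fun h => hj (hone j h)
    have hs := sum_eq_zero_of_mem_nullMargins hd ha
    rw [Fintype.sum_eq_single i hz] at hs
    funext j
    by_cases hj : j = i
    · rw [hj, hs]; rfl
    · rw [hz j hj]; rfl
  rw [dCirc, hbot, finrank_bot] at hdim
  omega

/-! ### The affine parametrisation -/

section Parametrisation

variable {S : Finset (Idx r)} (Δ : Module.Basis (Fin (dCirc S)) ℝ (nullMargins S))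

lemma quasiIndep_mem (hd : 1 ≤ d) (hΓ : (copulaArraysOn S).Nonempty) :
    quasiIndep S ∈ copulaArraysOn S :=
  (copulaArray_spec hd hΓ
    (unifArray_mem_probArraysOn (mem_probArraysOn_of_copula hΓ.some_mem))).1

lemma gam_eq_add_repr_symm (θ : Param S) :
    gam Δ θ = quasiIndep S + (Δ.equivFun.symm θ.ofLp : nullMargins S) := by
  simp [gam, Module.Basis.equivFun_symm_apply]

lemma gam_injective : Function.Injective (gam Δ) := by
  intro θ θ' h
  rw [gam_eq_add_repr_symm, gam_eq_add_repr_symm, add_right_inj, SetLike.coe_eq_coe,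
    EmbeddingLike.apply_eq_iff_eq] at h
  exact WithLp.ofLp_injective 2 h

lemma gam_apply (θ : Param S) (i : Idx r) :
    gam Δ θ i = quasiIndep S i + ∑ k, θ k * (Δ k : Arr r) i := by
  simp [gam, Finset.sum_apply]

lemma gam_mem (hd : 1 ≤ d) (hΓ : (copulaArraysOn S).Nonempty) {θ : Param S}
    (hθ : θ ∈ paramSet Δ) : gam Δ θ ∈ copulaArraysOn S := by
  have hq := quasiIndep_mem hd hΓ
  have hz : ∀ i, i ∉ S → gam Δ θ i = 0 := fun i hi => by
    rw [gam_eq_add_repr_symm, Pi.add_apply, probArraysOn_eq_zero (mem_probArraysOn_of_copula hq) hi,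
      supp_subset_iff.1 (Δ.equivFun.symm θ.ofLp).2.1 i hi, add_zero]
  refine ⟨?_, ?_⟩
  · rw [gam_eq_add_repr_symm]
    refine add_mem_copulaArrays hd hq.1 (Δ.equivFun.symm θ.ofLp).2 fun i => ?_
    rw [← gam_eq_add_repr_symm]
    by_cases hi : i ∈ S
    · exact (hθ i hi).1.le
    · exact (hz i hi).ge
  · exact (supp_subset_iff.2 hz).antisymm fun i hi => mem_supp.2 (hθ i hi).1.ne'

lemma exists_gam_eq (hd : 1 ≤ d) (hΓ : (copulaArraysOn S).Nonempty) (hdim : 1 ≤ dCirc S)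
    {g : Arr r} (hg : g ∈ copulaArraysOn S) : ∃ θ ∈ paramSet Δ, gam Δ θ = g := by
  have hq := quasiIndep_mem hd hΓ
  have hmem := copulaArrays_sub_mem_nullMargins hq.1 hg.1 hq.2.le hg.2.le
  have h : gam Δ (WithLp.toLp 2 (Δ.equivFun ⟨_, hmem⟩)) = g := by
    rw [gam_eq_add_repr_symm]
    simp
  refine ⟨_, fun i hi => ?_, h⟩
  rw [h]
  exact ⟨probArraysOn_pos (mem_probArraysOn_of_copula hg) hi, copulaArraysOn_lt_one hd hdim hg i⟩

lemma isUniqueArgMin_gam (hd : 1 ≤ d) (hΓ : (copulaArraysOn S).Nonempty) {p : Arr r}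
    (hp : p ∈ probArraysOn S) {θ : Param S} (hθ : θ ∈ paramSet Δ)
    (hc : IsCritical S (gam Δ θ) p) :
    IsUniqueArgMin (fun θ => iDiv (gam Δ θ) p) (paramSet Δ) θ := by
  have h := hc.isUniqueArgMin hd hp (gam_mem Δ hd hΓ hθ)
  exact ⟨hθ, fun θ' hθ' hne =>
    h.2 _ (gam_mem Δ hd hΓ hθ').1 fun h' => hne (gam_injective Δ h')⟩

lemma unvec_vec (a : Arr r) : unvec (vec a) = a := by
  funext i
  simp [unvec, vec]

lemma thetaStar_eq_of_isCritical (hd : 1 ≤ d) (hΓ : (copulaArraysOn S).Nonempty) {p : Arr r}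
    (hp : p ∈ probArraysOn S) {θ : Param S} (hθ : θ ∈ paramSet Δ)
    (hc : IsCritical S (gam Δ θ) p) : thetaStar Δ (vec p) = θ := by
  rw [thetaStar, unvec_vec]
  exact (isUniqueArgMin_gam Δ hd hΓ hp hθ hc).argMin_eq

lemma thetaStar_spec (hd : 1 ≤ d) (hΓ : (copulaArraysOn S).Nonempty) (hdim : 1 ≤ dCirc S)
    {p : Arr r} (hp : p ∈ probArraysOn S) :
    thetaStar Δ (vec p) ∈ paramSet Δ ∧ gam Δ (thetaStar Δ (vec p)) = copulaArray p := by
  obtain ⟨hg, hc⟩ := copulaArray_spec hd hΓ hp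
  obtain ⟨θ, hθ, e⟩ := exists_gam_eq Δ hd hΓ hdim hg
  rw [thetaStar_eq_of_isCritical Δ hd hΓ hp hθ (e ▸ hc)]
  exact ⟨hθ, e⟩

end Parametrisation

end DiscreteCopula

namespace DiscreteCopula

variable {d : ℕ} {r : Fin d → ℕ}

/-! ### Matrices attached to the parametrisation -/

/-- The continuous linear map between Euclidean spaces given by a matrix. -/
noncomputable def matCLM {m n : Type*} [Fintype m] [Fintype n] [DecidableEq n]
    (M : Matrix m n ℝ) : EuclideanSpace ℝ n →L[ℝ] EuclideanSpace ℝ m :=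
  (Matrix.toLpLin 2 2 M).toContinuousLinearMap

lemma matCLM_apply {m n : Type*} [Fintype m] [Fintype n] [DecidableEq n]
    (M : Matrix m n ℝ) (v : EuclideanSpace ℝ n) :
    matCLM M v = WithLp.toLp 2 (Matrix.mulVec M v.ofLp) := rfl

lemma matCLM_mul_apply {l m n : Type*} [Fintype l] [Fintype m] [Fintype n] [DecidableEq m]
    [DecidableEq n] (M : Matrix l m ℝ) (N : Matrix m n ℝ) (v : EuclideanSpace ℝ n) :
    matCLM M (matCLM N v) = matCLM (M * N) v := by
  simp [matCLM_apply, Matrix.mulVec_mulVec]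

/-- The continuous linear equivalence given by an invertible matrix. -/
noncomputable def matCLE {n : Type*} [Fintype n] [DecidableEq n] (M : Matrix n n ℝ)
    (hM : IsUnit M) : EuclideanSpace ℝ n ≃L[ℝ] EuclideanSpace ℝ n :=
  ContinuousLinearEquiv.equivOfInverse (matCLM M) (matCLM M⁻¹)
    (fun v => by
      rw [matCLM_mul_apply, Matrix.nonsing_inv_mul _ ((Matrix.isUnit_iff_isUnit_det _).1 hM)]
      simp [matCLM_apply])
    (fun v => by
      rw [matCLM_mul_apply, Matrix.mul_nonsing_inv _ ((Matrix.isUnit_iff_isUnit_det _).1 hM)]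
      simp [matCLM_apply])

section Parametrisation

open scoped Matrix

variable {S : Finset (Idx r)} (Δ : Module.Basis (Fin (dCirc S)) ℝ (nullMargins S))

lemma matR_mulVec (S : Finset (Idx r)) (v : Vect r) (i : S) :
    Matrix.mulVec (matR S) v.ofLp i = v (finPiFinEquiv (i : Idx r)) := by
  simp [matR, Matrix.mulVec, dotProduct, Matrix.one_apply]

lemma vec_apply_equiv (a : Arr r) (i : Idx r) : vec a (finPiFinEquiv i) = a i := by
  simp [vec]

lemma matR_mulVec_vec (S : Finset (Idx r)) (a : Arr r) :
    Matrix.mulVec (matR S) (vec a).ofLp = fun i : S => a i := by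
  funext i
  rw [matR_mulVec, vec_apply_equiv]

lemma matAt_apply (i : S) (k : Fin (dCirc S)) : matAt Δ i k = (Δ k : Arr r) i := by
  have h := congrFun (matR_mulVec_vec S (Δ k : Arr r)) i
  rw [← h]
  rfl

lemma gam_apply_matAt (θ : Param S) (i : S) :
    gam Δ θ i = quasiIndep S i + Matrix.mulVec (matAt Δ) θ.ofLp i := by
  simp [gam_apply, Matrix.mulVec, dotProduct, matAt_apply, mul_comm]

lemma invDiag_vec {g : Arr r} (hg : ∀ i ∈ S, 0 < g i) :
    invDiag S (vec g) = Matrix.diagonal fun i : S => (g i)⁻¹ := by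
  rw [invDiag, matR_mulVec_vec]
  refine Matrix.inv_eq_left_inv ?_
  rw [Matrix.diagonal_mul_diagonal, ← Matrix.diagonal_one]
  congr 1
  funext i
  exact inv_mul_cancel₀ (hg i i.2).ne'

/-- Full column rank of Ã: basis arrays vanish off S, so restricting them to S loses no information.
-/
lemma matAt_mulVec_injective : Function.Injective (matAt Δ).mulVec := by
  intro x y hxy
  refine WithLp.toLp_injective 2 (gam_injective Δ (funext fun i => ?_))
  by_cases hi : i ∈ S
  · have := gam_apply_matAt Δ (WithLp.toLp 2 x) ⟨i, hi⟩
    have h' := gam_apply_matAt Δ (WithLp.toLp 2 y) ⟨i, hi⟩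
    simp only at this h'
    rw [this, h', hxy]
  · simp [gam_apply, supp_subset_iff.1 (Δ _).2.1 i hi]

lemma infoMat_posDef {g : Arr r} (hg : ∀ i ∈ S, 0 < g i) : (infoMat Δ (vec g)).PosDef := by
  rw [infoMat, invDiag_vec hg, ← Matrix.conjTranspose_eq_transpose_of_trivial]
  exact (Matrix.PosDef.diagonal fun i : S => inv_pos.2 (hg i i.2)).conjTranspose_mul_mul_same
    (matAt_mulVec_injective Δ)

lemma sigmaTheta_posSemidef {p : Arr r} (hp : ∀ i ∈ S, 0 < p i)
    (hg : ∀ i ∈ S, 0 < copulaArray p i) : (sigmaTheta Δ p).PosSemidef := by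
  have h := (infoMat_posDef Δ hp).posSemidef.mul_mul_conjTranspose_same
    (infoMat Δ (vec (copulaArray p)))⁻¹
  rwa [(infoMat_posDef Δ hg).inv.isHermitian.eq] at h

lemma sum_vec (a : Arr r) : ∑ j, vec a j = ∑ i, a i := by
  rw [← finPiFinEquiv.sum_comp]
  simp only [vec_apply_equiv]

lemma dotProduct_multinomialCov_mulVec (v : Vect r) (x : Fin (∏ l, r l) → ℝ) :
    x ⬝ᵥ multinomialCov v *ᵥ x = ∑ j, v j * x j ^ 2 - (∑ j, v j * x j) ^ 2 := by
  rw [multinomialCov, Matrix.sub_mulVec, dotProduct_sub]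
  congr 1
  · simp only [dotProduct, Matrix.mulVec_diagonal]
    exact Finset.sum_congr rfl fun j _ => by ring
  · rw [Matrix.vecMulVec_mulVec, dotProduct_smul, sq]
    simp [dotProduct, mul_comm]

lemma multinomialCov_posSemidef {p : Arr r} (h0 : ∀ i, 0 ≤ p i) (h1 : ∑ i, p i = 1) :
    (multinomialCov (vec p)).PosSemidef := by
  refine Matrix.PosSemidef.of_dotProduct_mulVec_nonneg ?_ fun x => ?_
  · ext i j
    rcases eq_or_ne i j with rfl | h
    · simp
    · simp [multinomialCov, Matrix.diagonal_apply_ne _ h, Matrix.diagonal_apply_ne _ h.symm,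
        Matrix.vecMulVec_apply, mul_comm]
  · rw [star_trivial, dotProduct_multinomialCov_mulVec, sub_nonneg,
      ← one_mul (∑ j, vec p j * x j ^ 2), ← h1, ← sum_vec]
    -- Cauchy–Schwarz with weights `p`: (∑ p x)² ≤ (∑ p)(∑ p x²).
    exact Finset.sum_sq_le_sum_mul_sum_of_sq_le_mul _ (fun j _ => h0 _)
      (fun j _ => mul_nonneg (h0 _) (sq_nonneg _)) fun j _ => le_of_eq (by ring)

lemma jacTheta_mul_cov_mul_transpose (hd : 1 ≤ d) (hΓ : (copulaArraysOn S).Nonempty)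
    (hdim : 1 ≤ dCirc S) {p : Arr r} (hp : p ∈ probArraysOn S) :
    jacTheta Δ (vec p) * multinomialCov (vec p) * (jacTheta Δ (vec p)).transpose =
      sigmaTheta Δ p := by
  have hg := (copulaArray_spec hd hΓ hp).1
  have hsp := (thetaStar_spec Δ hd hΓ hdim hp).2
  have hJ : jacTheta Δ (vec p) = (infoMat Δ (vec (copulaArray p)))⁻¹ *
      ((matAt Δ).transpose * invDiag S (vec p) * matR S) := by
    rw [jacTheta, gamStar, hsp]
    simp only [Matrix.mul_assoc]
  set M := infoMat Δ (vec (copulaArray p)) with hM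
  have hMsymm : (M⁻¹).transpose = M⁻¹ := by
    rw [← Matrix.conjTranspose_eq_transpose_of_trivial]
    exact (infoMat_posDef Δ fun i hi =>
      probArraysOn_pos (mem_probArraysOn_of_copula hg) hi).inv.isHermitian.eq
  set B := (matAt Δ).transpose * invDiag S (vec p) * matR S with hB
  have hone : Matrix.diagonal (fun i : S => (p i)⁻¹) *ᵥ (fun i : S => p i) = fun _ => 1 := by
    funext i
    rw [Matrix.mulVec_diagonal]
    exact inv_mul_cancel₀ (probArraysOn_pos hp i.2).ne'
  -- On S, diag⁻¹(p) sends p to the all-ones vector, and each Δ k has total sum zero. This kills the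
  -- rank-one part of the covariance.
  have hBp : B *ᵥ (vec p).ofLp = 0 := by
    rw [hB, ← Matrix.mulVec_mulVec, matR_mulVec_vec, ← Matrix.mulVec_mulVec,
      invDiag_vec fun i hi => probArraysOn_pos hp hi, hone]
    funext k
    simp only [Matrix.mulVec, dotProduct, Matrix.transpose_apply, matAt_apply, mul_one,
      Pi.zero_apply]
    rw [Finset.sum_coe_sort S fun i => (Δ k : Arr r) i, sum_eq_of_supp_subset (Δ k).2.1,
      sum_eq_zero_of_mem_nullMargins hd (Δ k).2]
  have hRR : matR S * Matrix.diagonal (vec p).ofLp * (matR S).transpose =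
      Matrix.diagonal fun i : S => p i := by
    ext i j
    have hR : ∀ (i : S) k, matR S i k = if finPiFinEquiv (i : Idx r) = k then 1 else 0 :=
      fun i k => rfl
    rw [Matrix.mul_apply, Finset.sum_eq_single (finPiFinEquiv (j : Idx r))]
    · rw [Matrix.mul_diagonal, Matrix.transpose_apply, hR, hR, if_pos rfl, vec_apply_equiv,
        mul_one, Matrix.diagonal_apply]
      by_cases hij : i = j
      · simp [hij]
      · rw [if_neg hij, if_neg fun h => hij (Subtype.ext (finPiFinEquiv.injective h)), zero_mul]
    · intro k _ hk
      rw [Matrix.transpose_apply, hR j k, if_neg hk.symm, mul_zero]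
    · simp
  have hBcov : B * multinomialCov (vec p) * B.transpose = infoMat Δ (vec p) := by
    rw [multinomialCov, Matrix.mul_sub, Matrix.sub_mul, Matrix.mul_vecMulVec, hBp,
      Matrix.zero_vecMulVec, Matrix.zero_mul, sub_zero, hB, infoMat,
      invDiag_vec fun i hi => probArraysOn_pos hp hi]
    simp only [Matrix.transpose_mul, Matrix.transpose_transpose, Matrix.diagonal_transpose]
    calc _ = (matAt Δ).transpose * Matrix.diagonal (fun i : S => (p i)⁻¹) *
          (matR S * Matrix.diagonal (vec p).ofLp * (matR S).transpose) *
          (Matrix.diagonal (fun i : S => (p i)⁻¹) * matAt Δ) := by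
            simp only [Matrix.mul_assoc]
      _ = (matAt Δ).transpose * (Matrix.diagonal (fun i : S => (p i)⁻¹) *
          Matrix.diagonal (fun i : S => p i)) *
          (Matrix.diagonal (fun i : S => (p i)⁻¹) * matAt Δ) := by
            rw [hRR]
            simp only [Matrix.mul_assoc]
      _ = _ := by
        rw [Matrix.diagonal_mul_diagonal]
        have : (fun i : S => (p i)⁻¹ * p i) = 1 :=
          funext fun i => inv_mul_cancel₀ (probArraysOn_pos hp i.2).ne'
        rw [this, Matrix.diagonal_one', Matrix.mul_one, Matrix.mul_assoc]
  rw [hJ, Matrix.transpose_mul, hMsymm, sigmaTheta, ← hBcov, ← hM]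
  simp only [Matrix.mul_assoc]

/-! ### The score map and the differentiability of `θ*` -/

/-- The vector `Ã_Sᵀ log w`. -/
noncomputable def score (w : S → ℝ) : Param S :=
  WithLp.toLp 2 (Matrix.mulVec (matAt Δ).transpose fun i => Real.log (w i))

/-- Stated for a general affine argument to serve both sides of the score equation; strictness is
what the inverse function theorem requires. -/
lemma hasStrictFDerivAt_score {n : Type*} [Fintype n] [DecidableEq n] (c : S → ℝ)
    (B : Matrix S n ℝ) (x : EuclideanSpace ℝ n)
    (h : ∀ i, c i + Matrix.mulVec B x.ofLp i ≠ 0) :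
    HasStrictFDerivAt
      (fun x : EuclideanSpace ℝ n => score Δ fun i => c i + Matrix.mulVec B x.ofLp i)
      (matCLM ((matAt Δ).transpose *
        Matrix.diagonal (fun i => (c i + Matrix.mulVec B x.ofLp i)⁻¹) * B)) x := by
  rw [hasStrictFDerivAt_euclidean]
  intro k
  have h1 : ∀ i : S, HasStrictFDerivAt
      (fun x : EuclideanSpace ℝ n => c i + Matrix.mulVec B x.ofLp i)
      (PiLp.proj 2 (fun _ : S => ℝ) i ∘L matCLM B) x := fun i =>
    (PiLp.proj (𝕜 := ℝ) 2 (fun _ : S => ℝ) i ∘L matCLM B).hasStrictFDerivAt.const_add (c i)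
  have h2 := HasStrictFDerivAt.fun_sum (u := Finset.univ) fun (i : S) _ =>
    ((h1 i).log (h i)).const_mul (matAt Δ i k)
  refine h2.congr_fderiv ?_
  ext v
  simp [matCLM_apply, Matrix.mulVec_diagonal, ← Matrix.mulVec_mulVec, Matrix.mulVec_transpose,
    Matrix.vecMul, dotProduct]
  exact Finset.sum_congr rfl fun i _ => by ring

/-- Criticality is linear in the direction, so it may be tested on the basis Δ, where it is the
score equation coordinate by coordinate. -/
lemma isCritical_of_score_eq {g p : Arr r} (hg : ∀ i ∈ S, 0 < g i)
    (hp : ∀ i ∈ S, 0 < p i) (h : score Δ (fun i => g i) = score Δ fun i => p i) :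
    IsCritical S g p := by
  let φ : nullMargins S →ₗ[ℝ] ℝ :=
    { toFun := fun a => ∑ i ∈ S, (a : Arr r) i * Real.log (g i / p i)
      map_add' := fun a b => by simp [add_mul, Finset.sum_add_distrib]
      map_smul' := fun t a => by simp [Finset.mul_sum, mul_assoc] }
  have hφ : φ = 0 := by
    refine Δ.ext fun k => ?_
    have hk := congrArg (fun v : Param S => v k) h
    simp only [score, Matrix.mulVec, dotProduct, Matrix.transpose_apply, matAt_apply] at hk
    rw [Finset.sum_coe_sort S fun i => (Δ k : Arr r) i * Real.log (g i),
      Finset.sum_coe_sort S fun i => (Δ k : Arr r) i * Real.log (p i)] at hk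
    simp only [φ, LinearMap.coe_mk, AddHom.coe_mk, LinearMap.zero_apply]
    rw [← sub_eq_zero.2 hk, ← Finset.sum_sub_distrib]
    refine Finset.sum_congr rfl fun i hi => ?_
    rw [Real.log_div (hg i hi).ne' (hp i hi).ne']
    ring
  exact fun a ha => congrArg (fun f : nullMargins S →ₗ[ℝ] ℝ => f ⟨a, ha⟩) hφ

lemma score_eq_of_isCritical {g p : Arr r} (hg : ∀ i ∈ S, 0 < g i)
    (hp : ∀ i ∈ S, 0 < p i) (h : IsCritical S g p) :
    score Δ (fun i => g i) = score Δ fun i => p i := by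
  ext k
  have hk := h _ (Δ k).2
  simp only [score, Matrix.mulVec, dotProduct, Matrix.transpose_apply, matAt_apply]
  rw [Finset.sum_coe_sort S fun i => (Δ k : Arr r) i * Real.log (g i),
      Finset.sum_coe_sort S fun i => (Δ k : Arr r) i * Real.log (p i), ← sub_eq_zero,
      ← Finset.sum_sub_distrib, ← hk]
  refine Finset.sum_congr rfl fun i hi => ?_
  rw [Real.log_div (hg i hi).ne' (hp i hi).ne']
  ring

lemma isOpen_paramSet : IsOpen (paramSet Δ) := by
  have hc : ∀ i, Continuous fun θ : Param S => gam Δ θ i := fun i => by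
    simp only [gam_apply]
    fun_prop
  have e : paramSet Δ = ⋂ i ∈ S, {θ | 0 < gam Δ θ i ∧ gam Δ θ i < 1} := by
    ext θ
    simp [paramSet]
  rw [e]
  exact isOpen_biInter_finset fun i _ =>
    (isOpen_lt continuous_const (hc i)).inter (isOpen_lt (hc i) continuous_const)

theorem hasFDerivWithinAt_thetaStar (hd : 1 ≤ d) (hΓ : (copulaArraysOn S).Nonempty)
    (hdim : 1 ≤ dCirc S) {p : Arr r} (hp : p ∈ probArraysOn S) :
    HasFDerivWithinAt (thetaStar Δ) (matCLM (jacTheta Δ (vec p))) (vec '' probArraysOn S)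
      (vec p) := by
  obtain ⟨hθ, hgam⟩ := thetaStar_spec Δ hd hΓ hdim hp
  obtain ⟨hg, hcrit⟩ := copulaArray_spec hd hΓ hp
  set θ₀ := thetaStar Δ (vec p) with hθ₀
  have hgpos : ∀ i ∈ S, 0 < gam Δ θ₀ i := fun i hi => (hθ i hi).1
  have hppos : ∀ i ∈ S, 0 < p i := fun i hi => probArraysOn_pos hp hi
  let G : Param S → Param S := fun θ =>
    score Δ fun i => quasiIndep S i + Matrix.mulVec (matAt Δ) θ.ofLp i
  have hGgam : ∀ θ, G θ = score Δ fun i : S => gam Δ θ i := fun θ => by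
    simp only [G, gam_apply_matAt]
  let L : Vect r → Param S := fun v => score Δ fun i => 0 + Matrix.mulVec (matR S) v.ofLp i
  have hLvec : ∀ a : Arr r, L (vec a) = score Δ fun i : S => a i := fun a => by
    simp only [L, matR_mulVec_vec, zero_add]
  have hunit : IsUnit (infoMat Δ (vec (gam Δ θ₀))) := (infoMat_posDef Δ hgpos).isUnit
  have hG : HasStrictFDerivAt G
      (matCLE (infoMat Δ (vec (gam Δ θ₀))) hunit : Param S →L[ℝ] Param S) θ₀ := by
    refine (hasStrictFDerivAt_score Δ (fun i => quasiIndep S i) (matAt Δ) θ₀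
      fun i => ?_).congr_fderiv ?_
    · rw [← gam_apply_matAt]
      exact (hgpos i i.2).ne'
    · simp only [← gam_apply_matAt]
      rw [← invDiag_vec hgpos]
      rfl
  have hL : HasFDerivAt L (matCLM ((matAt Δ).transpose * invDiag S (vec p) * matR S)) (vec p) := by
    refine ((hasStrictFDerivAt_score Δ (fun _ => 0) (matR S) (vec p) fun i => ?_).congr_fderiv
      ?_).hasFDerivAt
    · rw [matR_mulVec_vec, zero_add]
      exact (hppos i i.2).ne'
    · simp only [matR_mulVec_vec, zero_add]
      rw [← invDiag_vec hppos]
  have hLG : L (vec p) = G θ₀ := by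
    rw [hLvec, hGgam]
    exact (score_eq_of_isCritical Δ hgpos hppos (hgam ▸ hcrit)).symm
  -- The candidate for θ* near `vec p` is v ↦ G⁻¹(L v), with derivative M(γ*)⁻¹ Ãᵀ diag⁻¹(Rp) R = J.
  have hinv := hG.to_localInverse.hasFDerivAt
  have hcomp : HasFDerivAt (fun v => hG.localInverse G _ θ₀ (L v))
      (matCLM (jacTheta Δ (vec p))) (vec p) := by
    rw [← hLG] at hinv
    refine (hinv.comp (vec p) hL).congr_fderiv ?_
    ext1 v
    have e : jacTheta Δ (vec p) = (infoMat Δ (vec (gam Δ θ₀)))⁻¹ *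
        ((matAt Δ).transpose * invDiag S (vec p) * matR S) := by
      rw [jacTheta, gamStar]
      simp only [Matrix.mul_assoc, ← hθ₀]
    rw [e, ← matCLM_mul_apply]
    rfl
  have hval : hG.localInverse G _ θ₀ (L (vec p)) = θ₀ := by
    rw [hLG]
    exact hG.localInverse_apply_image
  have hLt : Tendsto L (𝓝 (vec p)) (𝓝 (G θ₀)) := hLG ▸ hL.continuousAt.tendsto
  have hev1 : ∀ᶠ v in 𝓝 (vec p), G (hG.localInverse G _ θ₀ (L v)) = L v :=
    hLt.eventually hG.eventually_right_inverse
  have hev2 : ∀ᶠ v in 𝓝 (vec p), hG.localInverse G _ θ₀ (L v) ∈ paramSet Δ := by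
    refine hcomp.continuousAt.eventually ?_
    dsimp only
    rw [hval]
    exact (isOpen_paramSet Δ).mem_nhds hθ
  -- For v = `vec p'` near `vec p`, the candidate lies in the open set Θ and solves the score
  -- equation, hence is the unique minimiser.
  refine hcomp.hasFDerivWithinAt.congr_of_eventuallyEq ?_ hval.symm
  filter_upwards [mem_nhdsWithin_of_mem_nhds (hev1.and hev2), self_mem_nhdsWithin] with v hv hvS
  obtain ⟨p', hp', rfl⟩ := hvS
  refine thetaStar_eq_of_isCritical Δ hd hΓ hp' hv.2 (isCritical_of_score_eq Δ
    (fun i hi => (hv.2 i hi).1) (fun i hi => probArraysOn_pos hp' hi) ?_)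
  rw [← hGgam, ← hLvec]
  exact hv.1

end Parametrisation

end DiscreteCopula

namespace DiscreteCopula

/-! ### Convergence in probability and in law -/

section Convergence

open scoped ENNReal

variable {Ω Ω' Ω'' : Type*} [MeasurableSpace Ω] {μ : Measure Ω}
  [MeasurableSpace Ω'] {μ' : Measure Ω'} [MeasurableSpace Ω''] {μ'' : Measure Ω''}

lemma tendstoInMeasure_comp_of_continuousWithinAt {E F : Type*} [PseudoMetricSpace E]
    [PseudoMetricSpace F] {f : E → F} {s : Set E} {c : E} (hf : ContinuousWithinAt f s c)
    {Y : ℕ → Ω → E} (hs : ∀ n, ∀ᵐ ω ∂μ, Y n ω ∈ s)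
    (hY : TendstoInMeasure μ Y atTop fun _ => c) :
    TendstoInMeasure μ (fun n ω => f (Y n ω)) atTop fun _ => f c := by
  rw [tendstoInMeasure_iff_dist] at hY ⊢
  intro ε hε
  obtain ⟨δ, hδ, h⟩ := Metric.continuousWithinAt_iff.1 hf ε hε
  refine tendsto_of_tendsto_of_tendsto_of_le_of_le tendsto_const_nhds (hY δ hδ)
    (fun _ => zero_le) fun n => measure_mono_ae ?_
  filter_upwards [hs n] with ω hω hε'
  by_contra hlt
  exact absurd (h hω (not_le.1 hlt)) (not_lt.2 hε')

variable [IsProbabilityMeasure μ] [IsProbabilityMeasure μ'] [IsProbabilityMeasure μ'']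

/-- Portmanteau on the closed set {dist ≥ ε}, which has no mass under the Dirac limit. -/
lemma tendstoInMeasure_of_tendstoInDistribution_const {E : Type*} [NormedAddCommGroup E]
    [MeasurableSpace E] [BorelSpace E] {W : ℕ → Ω → E} {c : E}
    (h : TendstoInDistribution W atTop (fun _ : Ω' => c) (fun _ => μ) μ') :
    TendstoInMeasure μ W atTop fun _ => c := by
  rw [tendstoInMeasure_iff_dist]
  intro ε hε
  have hcl : IsClosed {x : E | ε ≤ dist x c} := isClosed_le continuous_const (by fun_prop)
  have h1 := ProbabilityMeasure.limsup_measure_closed_le_of_tendsto h.tendsto hcl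
  have h2 : (μ'.map fun _ => c) {x : E | ε ≤ dist x c} = 0 := by
    rw [Measure.map_const, measure_univ, one_smul, Measure.dirac_apply' _ hcl.measurableSet]
    simp [hε]
  have h3 : ∀ n, μ {ω | ε ≤ dist (W n ω) c} = (μ.map (W n)) {x : E | ε ≤ dist x c} := fun n =>
    (Measure.map_apply_of_aemeasurable (h.forall_aemeasurable n) hcl.measurableSet).symm
  simp only [h3]
  refine tendsto_of_le_liminf_of_limsup_le zero_le (h1.trans_eq ?_)
  simpa using h2

lemma tendstoInDistribution_of_map_eq {E : Type*} [TopologicalSpace E] [MeasurableSpace E]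
    [OpensMeasurableSpace E] {W : ℕ → Ω → E} {Z : Ω' → E} {Z' : Ω'' → E}
    (h : TendstoInDistribution W atTop Z (fun _ => μ) μ') (hZ' : AEMeasurable Z' μ'')
    (e : μ'.map Z = μ''.map Z') :
    TendstoInDistribution W atTop Z' (fun _ => μ) μ'' := by
  refine ⟨h.forall_aemeasurable, hZ', ?_⟩
  have e' : (⟨μ''.map Z', Measure.isProbabilityMeasure_map hZ'⟩ : ProbabilityMeasure E) =
      ⟨μ'.map Z, Measure.isProbabilityMeasure_map h.aemeasurable_limit⟩ := Subtype.ext e.symm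
  rw [e']
  exact h.tendsto

/-- **Delta method** for a map which is differentiable relative to a set that carries the
random vectors. -/
theorem tendstoInDistribution_delta_method {E F : Type*} [NormedAddCommGroup E] [NormedSpace ℝ E]
    [MeasurableSpace E] [BorelSpace E] [SecondCountableTopology E]
    [NormedAddCommGroup F] [NormedSpace ℝ F]
    [MeasurableSpace F] [BorelSpace F] [SecondCountableTopology F]
    {f : E → F} {f' : E →L[ℝ] F} {s : Set E} {c : E} (hf : HasFDerivWithinAt f f' s c)
    {Y : ℕ → Ω → E} (hs : ∀ n, ∀ᵐ ω ∂μ, Y n ω ∈ s)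
    (hfY : ∀ n, AEMeasurable (fun ω => f (Y n ω)) μ)
    {ρ : ℕ → ℝ} (hρ : Tendsto ρ atTop atTop) {Z : Ω' → E}
    (h : TendstoInDistribution (fun n ω => ρ n • (Y n ω - c)) atTop Z (fun _ => μ) μ') :
    TendstoInDistribution (fun n ω => ρ n • (f (Y n ω) - f c)) atTop (fun ω' => f' (Z ω'))
      (fun _ => μ) μ' := by
  have hρne : ∀ᶠ n in atTop, ρ n ≠ 0 := (hρ.eventually_gt_atTop 0).mono fun n hn => hn.ne'
  have hW := h.forall_aemeasurable
  -- Slutsky: Y n − c is ρ n⁻¹ → 0 times a sequence converging in law.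
  have hYc : TendstoInMeasure μ Y atTop fun _ => c := by
    have h0 : TendstoInMeasure μ (fun n (_ : Ω) => (ρ n)⁻¹) atTop fun _ => (0 : ℝ) :=
      tendstoInMeasure_of_tendsto_ae (fun n => aestronglyMeasurable_const)
        (ae_of_all _ fun _ => tendsto_inv_atTop_zero.comp hρ)
    have h1 := h.continuous_comp_prodMk_of_tendstoInMeasure_const
      (g := fun q : E × ℝ => q.2 • q.1) (by fun_prop) h0 fun n => aemeasurable_const
    simp only [zero_smul] at h1
    have h2 := tendstoInMeasure_of_tendstoInDistribution_const h1
    rw [tendstoInMeasure_iff_norm] at h2 ⊢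
    intro ε hε
    refine (h2 ε hε).congr' ?_
    filter_upwards [hρne] with n hn
    simp [smul_smul, inv_mul_cancel₀ hn]
  -- Normalised Taylor remainder. It is continuous at c within s with value 0, by the convention 0⁻¹
  -- = 0.
  let e : E → F := fun y => ‖y - c‖⁻¹ • (f y - f c - f' (y - c))
  have he : ContinuousWithinAt e s c := by
    have : e c = 0 := by simp [e]
    rw [ContinuousWithinAt, this, tendsto_zero_iff_norm_tendsto_zero]
    refine (hasFDerivWithinAt_iff_tendsto.1 hf).congr fun y => ?_
    simp [e, norm_smul]
  have hec : e c = 0 := by simp [e]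
  have heY := tendstoInMeasure_comp_of_continuousWithinAt he hs hYc
  let R : ℕ → Ω → F := fun n ω =>
    ‖ρ n • (Y n ω - c)‖⁻¹ • (ρ n • (f (Y n ω) - f c) - f' (ρ n • (Y n ω - c)))
  have hR : TendstoInMeasure μ R atTop fun _ => 0 := by
    rw [tendstoInMeasure_iff_norm] at heY ⊢
    intro ε hε
    refine (heY ε hε).congr' ?_
    filter_upwards [hρne] with n hn
    -- The normalised remainder is invariant in norm under scaling by ρ n ≠ 0.
    have : ∀ ω, ‖R n ω - 0‖ = ‖e (Y n ω) - e c‖ := fun ω => by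
      have hn' : |ρ n| ≠ 0 := abs_ne_zero.2 hn
      simp only [R, hec, sub_zero, e]
      rw [map_smul, ← smul_sub, norm_smul, norm_smul, norm_smul, norm_smul, norm_inv, norm_inv,
        norm_mul, norm_norm, norm_norm, mul_inv, Real.norm_eq_abs]
      field_simp
    simp only [this]
  have hRm : ∀ n, AEMeasurable (R n) μ := fun n =>
    (hW n).norm.inv.smul ((((hfY n).sub_const _).const_smul (ρ n)).sub
      (f'.continuous.measurable.comp_aemeasurable (hW n)))
  have hfin := h.continuous_comp_prodMk_of_tendstoInMeasure_const
    (g := fun q : E × F => f' q.1 + ‖q.1‖ • q.2) (by fun_prop) hR hRm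
  simp only [smul_zero, add_zero] at hfin
  refine hfin.congr (fun n => ae_of_all _ fun ω => ?_) (ae_of_all _ fun _ => rfl)
  -- If the scaled error is zero, then ρ n = 0 or Y n = c, and both sides vanish.
  by_cases h0 : ρ n • (Y n ω - c) = 0
  · simp only [h0, map_zero, norm_zero, zero_smul, add_zero]
    rcases smul_eq_zero.1 h0 with h' | h'
    · simp [h']
    · simp [sub_eq_zero.1 h']
  · simp only [R]
    rw [smul_smul, mul_inv_cancel₀ (norm_ne_zero_iff.2 h0), one_smul, add_sub_cancel]

/-- **Central limit theorem** for independent and identically distributed random vectors. -/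
theorem tendstoInDistribution_multivariate_clt {ι : Type*} [Fintype ι] [DecidableEq ι]
    {Y : ℕ → Ω → EuclideanSpace ℝ ι} (hind : iIndepFun Y μ)
    (hid : ∀ k, IdentDistrib (Y k) (Y 0) μ μ) (h2 : MemLp (Y 0) 2 μ)
    {m : EuclideanSpace ℝ ι} {C : Matrix ι ι ℝ} (hC : C.PosSemidef)
    (hm : ∀ t, ∫ ω, inner ℝ (Y 0 ω) t ∂μ = inner ℝ m t)
    (hv : ∀ t : EuclideanSpace ℝ ι, Var[fun ω => inner ℝ (Y 0 ω) t; μ] =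
      dotProduct t.ofLp (Matrix.mulVec C t.ofLp)) :
    TendstoInDistribution
      (fun (n : ℕ) ω => (√(n : ℝ))⁻¹ • (∑ k ∈ Finset.range n, Y k ω - (n : ℝ) • m)) atTop id
      (fun _ => μ) (multivariateGaussian 0 C) where
  forall_aemeasurable n :=
    ((Finset.aemeasurable_fun_sum _ fun k _ => (hid k).aemeasurable_fst).sub_const _).fun_const_smul _
  tendsto := by
    refine ProbabilityMeasure.tendsto_iff_tendsto_charFun.2 fun t => ?_
    have hmeas : Measurable fun y : EuclideanSpace ℝ ι => inner ℝ y t := by fun_prop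
    have hlaw : HasLaw id (gaussianReal 0 Var[fun ω => inner ℝ (Y 0 ω) t; μ].toNNReal)
        (gaussianReal 0 Var[fun ω => inner ℝ (Y 0 ω) t; μ].toNNReal) := HasLaw.id
    have hclt := tendstoInDistribution_inv_sqrt_mul_sum_sub hlaw
      (X := fun k ω => inner ℝ (Y k ω) t) (h2.inner_const t)
      (hind.comp (fun _ y => inner ℝ y t) fun _ => hmeas) fun k => (hid k).comp hmeas
    -- Cramér–Wold: the characteristic function of the vector at t is that of its projection on t at
    -- 1.
    have hch := ProbabilityMeasure.tendsto_iff_tendsto_charFun.1 hclt.tendsto 1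
    simp only [ProbabilityMeasure.coe_mk, Measure.map_id] at hch ⊢
    have hnn : 0 ≤ dotProduct t.ofLp (Matrix.mulVec C t.ofLp) := by
      simpa using hC.dotProduct_mulVec_nonneg t.ofLp
    have hlim : charFun (multivariateGaussian 0 C) t =
        charFun (gaussianReal 0 Var[fun ω => inner ℝ (Y 0 ω) t; μ].toNNReal) 1 := by
      rw [charFun_multivariateGaussian hC, charFun_gaussianReal, hv, Real.coe_toNNReal _ hnn]
      simp
    rw [hlim]
    refine hch.congr fun n => ?_
    have hmW : AEMeasurable
        (fun ω => (√(n : ℝ))⁻¹ • (∑ k ∈ Finset.range n, Y k ω - (n : ℝ) • m)) μ :=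
      ((Finset.aemeasurable_fun_sum _ fun k _ =>
        (hid k).aemeasurable_fst).sub_const _).fun_const_smul _
    rw [charFun_apply, charFun_apply, integral_map hmW (by fun_prop),
      integral_map (hclt.forall_aemeasurable n) (by fun_prop)]
    refine integral_congr_ae (ae_of_all _ fun ω => ?_)
    simp only [inner_smul_left, inner_sub_left, sum_inner, hm]
    simp

/-- The image of a centred Gaussian vector under a matrix. -/
lemma map_matCLM_multivariateGaussian {ι κ : Type*} [Fintype ι] [DecidableEq ι] [Fintype κ]
    [DecidableEq κ] {C : Matrix ι ι ℝ} (hC : C.PosSemidef) (J : Matrix κ ι ℝ) :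
    (multivariateGaussian 0 C).map (matCLM J) =
      multivariateGaussian 0 (J * C * J.transpose) := by
  have hJ : (J * C * J.transpose).PosSemidef := hC.mul_mul_conjTranspose_same J
  refine Measure.ext_of_charFun (funext fun t => ?_)
  have hin : ∀ v, inner ℝ (matCLM J v) t = inner ℝ v (matCLM J.transpose t) := fun v => by
    simp only [EuclideanSpace.inner_eq_star_dotProduct, matCLM_apply, star_trivial]
    rw [Matrix.dotProduct_mulVec, Matrix.mulVec_transpose]
  rw [charFun_apply, integral_map (by fun_prop) (by fun_prop)]
  simp only [hin]
  rw [← charFun_apply, charFun_multivariateGaussian hC, charFun_multivariateGaussian hJ]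
  congr 3
  · simp
  · simp only [matCLM_apply]
    rw [← Matrix.mulVec_mulVec, ← Matrix.mulVec_mulVec, Matrix.dotProduct_mulVec t.ofLp J,
      Matrix.mulVec_transpose]

end Convergence

end DiscreteCopula

namespace DiscreteCopula

variable {d : ℕ} {r : Fin d → ℕ}

/-! ### The sample -/

section Sample

lemma gridPt_injective {x : (l : Fin d) → Fin (r l) → ℝ} (hx : ∀ l, StrictMono (x l)) :
    Function.Injective (gridPt x) := fun _ _ h =>
  funext fun l => (hx l).injective (congrFun h l)

lemma indicator_gridPt {x : (l : Fin d) → Fin (r l) → ℝ} (hx : ∀ l, StrictMono (x l))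
    (i j : Idx r) :
    Set.indicator {gridPt x i} (fun _ => (1 : ℝ)) (gridPt x j) = if i = j then 1 else 0 := by
  rw [Set.indicator_apply]
  simp only [Set.mem_singleton_iff, (gridPt_injective hx).eq_iff]
  simp only [eq_comm]

variable {Ω : Type*} {x : (l : Fin d) → Fin (r l) → ℝ} {S : Finset (Idx r)}
  {X : ℕ → Ω → Fin d → ℝ}

lemma pHat_mem_probArraysOn (hx : ∀ l, StrictMono (x l)) {p : Arr r} (hp : p ∈ probArraysOn S)
    {ω : Ω} (hω : ∀ k, ∃ i ∈ S, X k ω = gridPt x i) (n : ℕ) :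
    pHat x S X n ω ∈ probArraysOn S := by
  have hq := unifArray_mem_probArraysOn hp
  have hn : (0 : ℝ) < (n : ℝ) + 1 := by positivity
  have hind : ∀ k, ∀ i, 0 ≤ Set.indicator {gridPt x i} (fun _ => (1 : ℝ)) (X k ω) := fun k i =>
    Set.indicator_nonneg (fun _ _ => zero_le_one) _
  refine mem_probArraysOn_of_pos hp (fun i hi => ?_) (fun i hi => ?_) ?_
  · simp only [pHat, empArray, Pi.add_apply, Pi.smul_apply, smul_eq_mul]
    have h1 := probArraysOn_pos hq hi
    have h2 := Finset.sum_nonneg fun k (_ : k ∈ Finset.range n) => hind k i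
    positivity
  · simp only [pHat, empArray, Pi.add_apply, Pi.smul_apply, smul_eq_mul]
    rw [probArraysOn_eq_zero hq hi, Finset.sum_eq_zero, mul_zero, mul_zero, mul_zero, add_zero]
    intro k _
    obtain ⟨j, hj, e⟩ := hω k
    rw [e, indicator_gridPt hx, if_neg]
    rintro rfl
    exact hi hj
  · simp only [pHat, empArray, Pi.add_apply, Pi.smul_apply, smul_eq_mul, Finset.sum_add_distrib,
      ← Finset.mul_sum]
    rw [hq.1.2.1, Finset.sum_comm]
    have : ∀ k ∈ Finset.range n,
        ∑ i, Set.indicator {gridPt x i} (fun _ => (1 : ℝ)) (X k ω) = 1 := by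
      intro k _
      obtain ⟨j, -, e⟩ := hω k
      simp [e, indicator_gridPt hx]
    rw [Finset.sum_congr rfl this]
    -- For n = 0 the empirical array is zero, but its weight is too, leaving q.
    rcases Nat.eq_zero_or_pos n with rfl | hpos
    · simp
    · have : (n : ℝ) ≠ 0 := by positivity
      simp only [Finset.sum_const, Finset.card_range, nsmul_eq_mul, mul_one]
      field_simp

lemma vec_add (a b : Arr r) : vec (a + b) = vec a + vec b := rfl

lemma vec_smul (t : ℝ) (a : Arr r) : vec (t • a) = t • vec a := rfl

lemma continuous_vec : Continuous (vec : Arr r → Vect r) :=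
  (PiLp.continuous_toLp 2 _).comp (continuous_pi fun _ => continuous_apply _)

/-- The one-hot encoding of a point of the grid. -/
noncomputable def oneHot (x : (l : Fin d) → Fin (r l) → ℝ) (y : Fin d → ℝ) : Vect r :=
  vec fun i => Set.indicator {gridPt x i} (fun _ => (1 : ℝ)) y

lemma vec_empArray (n : ℕ) (ω : Ω) :
    vec (empArray x X n ω) = (1 / (n : ℝ)) • ∑ k ∈ Finset.range n, oneHot x (X k ω) := by
  ext j
  simp [empArray, vec, oneHot]

variable [MeasurableSpace Ω] {μ : Measure Ω} {P : Measure (Fin d → ℝ)}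

lemma ae_exists_gridPt [IsProbabilityMeasure P]
    (hPx : ∀ᵐ y ∂P, y ∈ Set.range (gridPt x)) (hpS : probArrayOf x P ∈ probArraysOn S)
    (hX : ∀ k, HasLaw (X k) P μ) : ∀ᵐ ω ∂μ, ∀ k, ∃ i ∈ S, X k ω = gridPt x i := by
  have hP : ∀ᵐ y ∂P, ∃ i ∈ S, y = gridPt x i := by
    have h0 : ∀ᵐ y ∂P, ∀ i, i ∉ S → y ≠ gridPt x i := by
      rw [ae_all_iff]
      intro i
      rw [Filter.eventually_imp_distrib_left]
      intro hi
      have hz : P.real {gridPt x i} = 0 := probArraysOn_eq_zero hpS hi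
      have hz' : P {gridPt x i} = 0 := (measureReal_eq_zero_iff).1 hz
      simpa [ae_iff] using hz'
    filter_upwards [hPx, h0] with y hy hy0
    obtain ⟨i, rfl⟩ := hy
    exact ⟨i, by_contra fun hi => hy0 i hi rfl, rfl⟩
  rw [ae_all_iff]
  intro k
  refine ae_of_ae_map (p := fun y => ∃ i ∈ S, y = gridPt x i) (hX k).aemeasurable ?_
  rwa [(hX k).map_eq]

/-- Any function of `p̂_n` is a random element, because `p̂_n` is a function of finitely many
counts. -/
lemma aemeasurable_comp_pHat {β : Type*} [MeasurableSpace β] (hX : ∀ k, AEMeasurable (X k) μ)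
    (f : Arr r → β) (n : ℕ) : AEMeasurable (fun ω => f (pHat x S X n ω)) μ := by
  let cnt : Ω → Idx r → ℕ := fun ω i =>
    ∑ k ∈ Finset.range n, Set.indicator {gridPt x i} (fun _ => (1 : ℕ)) (X k ω)
  let F : (Idx r → ℕ) → β := fun c =>
    f (((n : ℝ) / (n + 1)) • (fun i => (1 / (n : ℝ)) * (c i : ℝ)) +
      (1 / ((n : ℝ) + 1)) • unifArray S)
  have hcnt : AEMeasurable cnt μ := aemeasurable_pi_lambda _ fun _ =>
    Finset.aemeasurable_fun_sum _ fun k _ =>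
      (measurable_const.indicator (measurableSet_singleton _)).comp_aemeasurable (hX k)
  have hF : Measurable F := measurable_of_countable F
  have e : (fun ω => f (pHat x S X n ω)) = F ∘ cnt := by
    funext ω
    simp only [F, cnt, Function.comp_apply, pHat]
    congr 3
    funext i
    simp [empArray, Set.indicator_apply]
  rw [e]
  exact hF.comp_aemeasurable hcnt

lemma measurable_oneHot : Measurable (oneHot x) :=
  continuous_vec.measurable.comp (measurable_pi_lambda _ fun _ =>
    measurable_const.indicator (measurableSet_singleton _))

lemma oneHot_gridPt (hx : ∀ l, StrictMono (x l)) (i : Idx r) (j : Fin (∏ l, r l)) :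
    oneHot x (gridPt x i) j = if j = finPiFinEquiv i then 1 else 0 := by
  have := indicator_gridPt hx (finPiFinEquiv.symm j) i
  rw [show oneHot x (gridPt x i) j = _ from this]
  simp only [Equiv.symm_apply_eq]

lemma integrable_oneHot_apply [IsFiniteMeasure P] (j : Fin (∏ l, r l)) :
    Integrable (fun y => oneHot x y j) P :=
  (integrable_const (1 : ℝ)).indicator (measurableSet_singleton _)

lemma integral_oneHot_apply (j : Fin (∏ l, r l)) :
    ∫ y, oneHot x y j ∂P = vec (probArrayOf x P) j :=
  integral_indicator_one (measurableSet_singleton _)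

lemma memLp_oneHot [IsFiniteMeasure P] : MemLp (oneHot x) 2 P := by
  refine MemLp.of_eval_piLp fun j => ?_
  exact (memLp_const (1 : ℝ)).indicator (measurableSet_singleton _)

lemma integral_inner_oneHot [IsFiniteMeasure P] (t : Vect r) :
    ∫ y, inner ℝ (oneHot x y) t ∂P = inner ℝ (vec (probArrayOf x P)) t := by
  simp only [PiLp.inner_apply, RCLike.inner_apply, conj_trivial]
  rw [integral_finsetSum _ fun j _ => (integrable_oneHot_apply j).const_mul _]
  simp only [integral_const_mul, integral_oneHot_apply]

/-- Exactly one coordinate of a one-hot vector is 1 on the grid, so the squared projection is ∑ t j²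
times the indicators. -/
lemma variance_inner_oneHot (hx : ∀ l, StrictMono (x l)) [IsProbabilityMeasure P]
    (hPx : ∀ᵐ y ∂P, y ∈ Set.range (gridPt x)) (t : Vect r) :
    Var[fun y => inner ℝ (oneHot x y) t; P] =
      dotProduct t.ofLp (Matrix.mulVec (multinomialCov (vec (probArrayOf x P))) t.ofLp) := by
  have hsq : ∫ y, (inner ℝ (oneHot x y) t) ^ 2 ∂P =
      ∫ y, ∑ j, t j ^ 2 * oneHot x y j ∂P := by
    refine integral_congr_ae ?_
    filter_upwards [hPx] with y hy
    obtain ⟨i, rfl⟩ := hy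
    simp [PiLp.inner_apply, oneHot_gridPt hx]
  rw [variance_eq_sub (memLp_oneHot.inner_const t), dotProduct_multinomialCov_mulVec]
  simp only [Pi.pow_apply]
  rw [hsq, integral_inner_oneHot,
    integral_finsetSum _ fun j _ => (integrable_oneHot_apply j).const_mul _]
  simp only [integral_const_mul, integral_oneHot_apply, PiLp.inner_apply, RCLike.inner_apply,
    conj_trivial]
  simp only [mul_comm]

theorem tendstoInDistribution_pHat (hx : ∀ l, StrictMono (x l)) [IsProbabilityMeasure P]
    [IsProbabilityMeasure μ] (hPx : ∀ᵐ y ∂P, y ∈ Set.range (gridPt x))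
    (hX : ∀ k, HasLaw (X k) P μ) (hind : iIndepFun X μ)
    (hC : (multinomialCov (vec (probArrayOf x P))).PosSemidef) :
    TendstoInDistribution
      (fun (n : ℕ) ω => √(n : ℝ) • (vec (pHat x S X n ω) - vec (probArrayOf x P))) atTop
      id (fun _ => μ) (multivariateGaussian 0 (multinomialCov (vec (probArrayOf x P)))) := by
  have hinner : ∀ t : Vect r, Measurable fun y => inner ℝ (oneHot x y) t := fun t =>
    (measurable_oneHot (x := x)).inner_const
  have hclt := tendstoInDistribution_multivariate_clt (Y := fun k ω => oneHot x (X k ω))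
    (m := vec (probArrayOf x P))
    (hind.comp (fun _ => oneHot x) fun _ => measurable_oneHot)
    (fun k => (⟨(hX k).aemeasurable, (hX 0).aemeasurable,
      (hX k).map_eq.trans (hX 0).map_eq.symm⟩ : IdentDistrib (X k) (X 0) μ μ).comp
        measurable_oneHot)
    (((hX 0).map_eq.symm ▸ memLp_oneHot : MemLp (oneHot x) 2 (μ.map (X 0))).comp_of_map
      (hX 0).aemeasurable) hC
    (fun t => by
      rw [← integral_inner_oneHot]
      exact (hX 0).integral_comp (f := fun y => inner ℝ (oneHot x y) t)
        (hinner t).aestronglyMeasurable)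
    (fun t => by
      rw [← variance_inner_oneHot hx hPx, ← (hX 0).map_eq,
        variance_map (hinner t).aemeasurable (hX 0).aemeasurable]
      rfl)
  have hsqrt : Tendsto (fun n : ℕ => √(n : ℝ)) atTop atTop :=
    Real.tendsto_sqrt_atTop.comp tendsto_natCast_atTop_atTop
  have ha : Tendsto (fun n : ℕ => (n : ℝ) / (n + 1)) atTop (𝓝 1) :=
    tendsto_natCast_div_add_atTop 1
  have hb : Tendsto (fun n : ℕ => √(n : ℝ) / (n + 1)) atTop (𝓝 0) := by
    -- Uses √n/(n+1) ≤ 1/√n.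
    refine squeeze_zero (fun n => by positivity) (fun n => ?_) (tendsto_inv_atTop_zero.comp hsqrt)
    rcases Nat.eq_zero_or_pos n with rfl | hn
    · simp
    · have h0 : (0 : ℝ) < √(n : ℝ) := Real.sqrt_pos.2 (by exact_mod_cast hn)
      have h1 := Real.mul_self_sqrt (Nat.cast_nonneg (α := ℝ) n)
      simp only [Function.comp_apply]
      rw [div_le_iff₀ (by positivity), inv_mul_eq_div, le_div_iff₀ h0]
      linarith
  have hab : TendstoInMeasure μ
      (fun (n : ℕ) (_ : Ω) => ((n : ℝ) / (n + 1), √(n : ℝ) / (n + 1))) atTop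
      fun _ => ((1 : ℝ), (0 : ℝ)) :=
    tendstoInMeasure_of_tendsto_ae (fun n => aestronglyMeasurable_const)
      (ae_of_all _ fun _ => ha.prodMk_nhds hb)
  -- Slutsky for √n(p̂_n − p) = n/(n+1)·√n(p_n − p) + √n/(n+1)·(q − p).
  have h := hclt.continuous_comp_prodMk_of_tendstoInMeasure_const
    (g := fun q : Vect r × ℝ × ℝ =>
      q.2.1 • q.1 + q.2.2 • (vec (unifArray S) - vec (probArrayOf x P)))
    (by fun_prop) hab fun n => aemeasurable_const
  simp only [one_smul, zero_smul, add_zero] at h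
  refine h.congr (fun n => ae_of_all _ fun ω => ?_) (ae_of_all _ fun _ => rfl)
  simp only [pHat, vec_add, vec_smul, vec_empArray]
  ext j
  simp only [PiLp.add_apply, PiLp.smul_apply, PiLp.sub_apply, smul_eq_mul]
  rcases Nat.eq_zero_or_pos n with rfl | hn
  · simp
  · have h0 : √(n : ℝ) ≠ 0 := (Real.sqrt_pos.2 (by exact_mod_cast hn)).ne'
    have h1 := Real.sq_sqrt (Nat.cast_nonneg (α := ℝ) n)
    have h2 : (n : ℝ) + 1 ≠ 0 := by positivity
    generalize √(n : ℝ) = s at *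
    rw [← h1] at h2 ⊢
    field_simp
    ring

end Sample

end DiscreteCopula

open DiscreteCopula in
theorem mainTheorem5
    {d : ℕ} (hd : 1 ≤ d) {r : Fin d → ℕ}
    -- the grid `𝒳₁ × ⋯ × 𝒳_d`, the distribution `P` on it, its probability array, of support `S`
    (x : (l : Fin d) → Fin (r l) → ℝ) (hx : ∀ l, StrictMono (x l))
    (P : Measure (Fin d → ℝ)) [IsProbabilityMeasure P]
    (hPx : ∀ᵐ y ∂P, y ∈ Set.range (gridPt x))
    (p : Arr r) (hp : p = probArrayOf x P)
    (S : Finset (Idx r)) (hpS : p ∈ probArraysOn S)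
    -- the two conditions on `S`, and the chosen basis of `Δ°(S)`
    (hΓ : (copulaArraysOn S).Nonempty) (hdim : 1 ≤ dCirc S)
    (Δ : Module.Basis (Fin (dCirc S)) ℝ (nullMargins S))
    -- the (possibly dependent) sample drawn from `P`
    {Ω : Type*} [MeasurableSpace Ω] (μ : Measure Ω) [IsProbabilityMeasure μ]
    (X : ℕ → Ω → Fin d → ℝ) (hX : ∀ k, HasLaw (X k) P μ) :
    -- the objects below are well defined
    ((∀ p' ∈ probArraysOn S,
        copulaArray p' ∈ copulaArraysOn S ∧
        IsUniqueArgMin (fun g => iDiv g p') (copulaArrays r) (copulaArray p') ∧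
        IsUniqueArgMin (fun θ => iDiv (gam Δ θ) p') (paramSet Δ) (thetaStar Δ (vec p'))) ∧
      unifArray S ∈ probArraysOn S ∧
      (∀ᵐ ω ∂μ, ∀ n, pHat x S X n ω ∈ probArraysOn S) ∧
      copulaArray p = gam Δ (thetaStar Δ (vec p)) ∧
      (infoMat Δ (vec (copulaArray p))).PosDef ∧
      (multinomialCov (vec p)).PosSemidef ∧
      (sigmaTheta Δ p).PosSemidef) ∧
    -- (a) weak and strong consistency
    ((TendstoInMeasure μ (fun n ω => pHat x S X n ω) atTop (fun _ => p) →
        TendstoInMeasure μ (fun n ω => thetaHat x X Δ n ω) atTop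
          (fun _ => thetaStar Δ (vec p))) ∧
      ((∀ᵐ ω ∂μ, Tendsto (fun n => pHat x S X n ω) atTop (𝓝 p)) →
        ∀ᵐ ω ∂μ, Tendsto (fun n => thetaHat x X Δ n ω) atTop (𝓝 (thetaStar Δ (vec p))))) ∧
    -- (b) limit in law
    (∀ (ρ : ℕ → ℝ), Tendsto ρ atTop atTop →
      ∀ (Ω' : Type*) [MeasurableSpace Ω'] (μ' : Measure Ω') [IsProbabilityMeasure μ']
        (Z : Ω' → Vect r),
        TendstoInDistribution (fun n ω => ρ n • (vec (pHat x S X n ω) - vec p)) atTop Z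
          (fun _ => μ) μ' →
        TendstoInDistribution
          (fun n ω => ρ n • (thetaHat x X Δ n ω - thetaStar Δ (vec p))) atTop
          (fun ω' => (WithLp.toLp 2 (Matrix.mulVec (jacTheta Δ (vec p)) (Z ω').ofLp) : Param S))
          (fun _ => μ) μ') ∧
    -- (c) asymptotic normality under independent sampling
    (iIndepFun X μ →
      TendstoInDistribution (fun (n : ℕ) ω => √(n : ℝ) • (vec (pHat x S X n ω) - vec p)) atTop
          id (fun _ => μ) (multivariateGaussian 0 (multinomialCov (vec p))) ∧
        TendstoInDistribution
          (fun (n : ℕ) ω => √(n : ℝ) • (thetaHat x X Δ n ω - thetaStar Δ (vec p))) atTop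
          id (fun _ => μ) (multivariateGaussian 0 (sigmaTheta Δ p))) := by
  subst hp
  have hgrid := ae_exists_gridPt hPx hpS hX
  have hmem : ∀ᵐ ω ∂μ, ∀ n, pHat x S X n ω ∈ probArraysOn S :=
    hgrid.mono fun ω hω n => pHat_mem_probArraysOn hx hpS hω n
  have hmem' : ∀ n, ∀ᵐ ω ∂μ, pHat x S X n ω ∈ probArraysOn S := ae_all_iff.1 hmem
  obtain ⟨hγ, -⟩ := copulaArray_spec hd hΓ hpS
  have hγpos : ∀ i ∈ S, 0 < copulaArray (probArrayOf x P) i := fun i hi =>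
    probArraysOn_pos (mem_probArraysOn_of_copula hγ) hi
  have hCov := multinomialCov_posSemidef (fun i => (hpS.1.1 i).1) hpS.1.2.1
  have hderiv := hasFDerivWithinAt_thetaStar Δ hd hΓ hdim hpS
  have hcont : ContinuousWithinAt (fun a => thetaStar Δ (vec a)) (probArraysOn S)
      (probArrayOf x P) :=
    hderiv.continuousWithinAt.comp continuous_vec.continuousWithinAt (Set.mapsTo_image _ _)
  have hmeas : ∀ n, AEMeasurable (fun ω => thetaHat x X Δ n ω) μ := fun n =>
    aemeasurable_comp_pHat (fun k => (hX k).aemeasurable) (fun a => thetaStar Δ (vec a)) n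
  have hvec : ∀ n, ∀ᵐ ω ∂μ, vec (pHat x S X n ω) ∈ vec '' probArraysOn S := fun n =>
    (hmem' n).mono fun ω hω => Set.mem_image_of_mem _ hω
  refine ⟨⟨fun p' hp' => ?_, unifArray_mem_probArraysOn hpS, hmem,
    (thetaStar_spec Δ hd hΓ hdim hpS).2.symm, infoMat_posDef Δ hγpos, hCov,
    sigmaTheta_posSemidef Δ (fun i hi => probArraysOn_pos hpS hi) hγpos⟩, ⟨fun h => ?_, fun h => ?_⟩,
    fun ρ hρ Ω' _ μ' _ Z hZ => ?_, fun hind => ?_⟩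
  · obtain ⟨hg, hc⟩ := copulaArray_spec hd hΓ hp'
    obtain ⟨hθ, e⟩ := thetaStar_spec Δ hd hΓ hdim hp'
    exact ⟨hg, hc.isUniqueArgMin hd hp' hg, isUniqueArgMin_gam Δ hd hΓ hp' hθ (e ▸ hc)⟩
  · exact tendstoInMeasure_comp_of_continuousWithinAt hcont hmem' h
  · filter_upwards [h, hmem] with ω hω hωS
    exact hcont.tendsto.comp
      (tendsto_nhdsWithin_iff.2 ⟨hω, Eventually.of_forall hωS⟩)
  · exact tendstoInDistribution_delta_method hderiv hvec hmeas hρ hZ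
  · have hclt := tendstoInDistribution_pHat (S := S) hx hPx hX hind hCov
    refine ⟨hclt, ?_⟩
    have h := tendstoInDistribution_delta_method hderiv hvec hmeas
      (Real.tendsto_sqrt_atTop.comp tendsto_natCast_atTop_atTop) hclt
    -- The delta method yields the limit as J applied to a Gaussian vector; its law is the Gaussian
    -- with covariance Σ_θ.
    refine tendstoInDistribution_of_map_eq h aemeasurable_id ?_
    rw [Measure.map_id, ← jacTheta_mul_cov_mul_transpose Δ hd hΓ hdim hpS]
    exact map_matCLM_multivariateGaussian hCov _
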